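/- Let $g$ be a finite-dimensional simple Lie algebra over $\mathbb{K}=\mathbb{R}$ or $\mathbb{C}$ with Killing form $(\cdot,\cdot)$, and let $t_0,t_+,t_-\in g$ satisfy $[t_0,t_\pm]=\pm t_\pm$ and $[t_+,t_-]=2t_0$ (an embedding of $sl_2$ into $g$, the trivial case $t_0=t_\pm=0$ being allowed). Smooth means $C^\infty$ if $\mathbb{K}=\mathbb{R}$ and holomorphic if $\mathbb{K}=\mathbb{C}$. The Kirillov bracket on $g$ is $\{F,G\}(x)=(x,[\mathrm{grad}_xF,\mathrm{grad}_xG])$, where $(\beta,\mathrm{grad}_xF)=\frac{d}{d\epsilon}F(x+\epsilon\beta)|_{\epsilon=0}$. Put $g_{lw}=\ker(\mathrm{ad}_{t_-})$ and identify $g_{lw}$ with the slice $S=t_++g_{lw}$ through $w\mapsto t_++w$. Let $\phi^1,\dots,\phi^r$ ($r=\dim g-\dim g_{lw}$) be affine functions on $g$ with linearly independent linear parts and common zero set $S$. Then the matrix $\Delta^{ij}=\{\phi^i,\phi^j\}$ is invertible at every point of $S$; with $\Delta_{ij}$ the entries of its inverse, the finite $W$ algebra $W(g;t_0)$ is the space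 of smooth functions on $S$ with the Dirac bracket $\{F|_S,G|_S\}^*=\big(\{F,G\}-\sum_{i,j}\{F,\phi^i\}\Delta_{ij}\{\phi^j,G\}\big)|_S$, and this is a Poisson bracket. The symplectic leaf through a point of $S$ is the set of all points reached from it by finitely many pieces of integral curves of Hamiltonian vector fields $X_f=\{f,\cdot\}^*$. A (co)adjoint orbit is an orbit of the connected adjoint group of $g$, the group generated by all $\exp(\mathrm{ad}_a)$, $a\in g$. Theorem. (i) For every (co)adjoint orbit $\mathcal{O}$ of $g$, the intersection $\mathcal{O}\cap S$ is (if non-empty) an embedded submanifold of $S$ that is an integral manifold of the Hamiltonian vector fields of $W(g;t_0)$: its tangent space at every point is the span of the Hamiltonian vector fields there, and the bracket is nondegenerate on it, i.e. is given on each tangent space by a nondegenerate alternating form $\omega$ with $\omega(X_f,X_h)=\{f,h\}^*$. The symplectic leaf of $W(g;t_0)$ through a point of $\mathcal{O}\cap S$ is the connected component of $\mathcal{O}\cap S$ containing that point; in particular $\mathcal{O}\cap S$ is itself a symplectic leaf whenever it is non-empty and connected. (ii) Generic leaves have dimension $\dim g_{lw}-\mathrm{rank}\,g$: if $\mathcal{O}$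 has dimension $\dim g-\mathrm{rank}\,g$ (equivalently, the centralizer of a point of $\mathcal{O}$ has dimension $\mathrm{rank}\,g$), then $\mathcal{O}\cap S$, if non-empty, has dimension $\dim g_{lw}-\mathrm{rank}\,g$ at each of its points; and the points of $S$ whose leaf has dimension $\dim g_{lw}-\mathrm{rank}\,g$ form an open dense subset of $S$. -/

import Mathlib

noncomputable section

namespace FiniteW

/-- A Lie ring whose additive group is normed. -/
class NormedLieRing (g : Type*) extends NormedAddCommGroup g, LieRing g

/-- A Lie algebra over `𝕜` whose underlying vector space is normed. It is only used for
finite-dimensional `g`, where all norms are equivalent and the bracket is automatically continuous;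
the norm just gives access to the differential calculus on `g`. -/
class NormedLieAlgebra (𝕜 : Type*) (g : Type*) [RCLike 𝕜] [NormedLieRing g] extends
  NormedSpace 𝕜 g, LieAlgebra 𝕜 g

/-! ### Poisson brackets and symplectic leaves on a vector space

For `𝕜 = ℝ` smooth functions are the `C^∞` functions, for `𝕜 = ℂ` the holomorphic ones. -/

section Poisson

variable {𝕜 V : Type*} [RCLike 𝕜] [NormedAddCommGroup V] [NormedSpace 𝕜 V]

/-- Smooth functions. -/
def IsSmooth (f : V → 𝕜) : Prop := ContDiff 𝕜 (⊤ : ℕ∞) f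

/-- `B` is a Poisson bracket on the algebra of smooth functions on `V`. -/
structure IsPoissonBracket (B : (V → 𝕜) → (V → 𝕜) → V → 𝕜) : Prop where
  smooth : ∀ f h, IsSmooth f → IsSmooth h → IsSmooth (B f h)
  add_left : ∀ f₁ f₂ h, IsSmooth f₁ → IsSmooth f₂ → IsSmooth h →
    B (f₁ + f₂) h = B f₁ h + B f₂ h
  smul_left : ∀ (c : 𝕜) (f h), IsSmooth f → IsSmooth h → B (c • f) h = c • B f h
  skew : ∀ f h, IsSmooth f → IsSmooth h → B f h = - B h f
  leibniz : ∀ f h₁ h₂, IsSmooth f → IsSmooth h₁ → IsSmooth h₂ →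
    B f (h₁ * h₂) = B f h₁ * h₂ + h₁ * B f h₂
  jacobi : ∀ f₁ f₂ f₃, IsSmooth f₁ → IsSmooth f₂ → IsSmooth f₃ →
    B f₁ (B f₂ f₃) + B f₂ (B f₃ f₁) + B f₃ (B f₁ f₂) = 0

/-- `v` is the value at `w` of the Hamiltonian vector field `X_f = {f, ·}`. -/
def IsHamiltonianVector (B : (V → 𝕜) → (V → 𝕜) → V → 𝕜) (f : V → 𝕜) (w v : V) : Prop :=
  ∀ h : V → 𝕜, IsSmooth h → fderiv 𝕜 h w v = B f h w

/-- The span at `w` of the Hamiltonian vector fields. -/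
def hamiltonianSpan (B : (V → 𝕜) → (V → 𝕜) → V → 𝕜) (w : V) : Submodule 𝕜 V :=
  Submodule.span 𝕜 {v | ∃ f, IsSmooth f ∧ IsHamiltonianVector B f w v}

/-- `w'` is reached from `w` by following an integral curve `γ` of a Hamiltonian vector field
`X_f` (in real time). The curve satisfies Hamilton's equation `d/dt h(γ(t)) = {f, h}(γ(t))` for
every smooth function `h`. -/
def HamiltonianFlow (B : (V → 𝕜) → (V → 𝕜) → V → 𝕜) (w w' : V) : Prop :=
  ∃ (f : V → 𝕜) (T : ℝ) (γ : ℝ → V), IsSmooth f ∧ 0 ≤ T ∧ γ 0 = w ∧ γ T = w' ∧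
    ∀ h : V → 𝕜, IsSmooth h → ∀ t ∈ Set.Icc 0 T,
      HasDerivWithinAt (fun s => h (γ s)) (B f h (γ t)) (Set.Icc 0 T) t

/-- The symplectic leaf through `w`: all the points that are reached from `w` by finitely many
pieces of integral curves of Hamiltonian vector fields. -/
def symplecticLeaf (B : (V → 𝕜) → (V → 𝕜) → V → 𝕜) (w : V) : Set V :=
  {w' | Relation.ReflTransGen (HamiltonianFlow B) w w'}

/-- `N` is a symplectic leaf of `B`. -/
def IsSymplecticLeaf (B : (V → 𝕜) → (V → 𝕜) → V → 𝕜) (N : Set V) : Prop :=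
  ∃ w, N = symplecticLeaf B w

/-- Near `w`, the set `N` is an embedded submanifold of `V`, with tangent space `T` at `w`:
a diffeomorphism `Φ` from a neighbourhood of `w` onto an open set straightens `N` to a linear
subspace `W`, and `T` is the preimage of `W` under the differential of `Φ` at `w`. -/
def IsSubmanifoldAt (N : Set V) (w : V) (T : Submodule 𝕜 V) : Prop :=
  ∃ (Φ : OpenPartialHomeomorph V V) (W : Submodule 𝕜 V), w ∈ Φ.source ∧
    ContDiffOn 𝕜 (⊤ : ℕ∞) Φ Φ.source ∧ ContDiffOn 𝕜 (⊤ : ℕ∞) Φ.symm Φ.target ∧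
    (∀ v ∈ Φ.source, v ∈ N ↔ Φ v ∈ W) ∧
    T = W.comap (fderiv 𝕜 Φ w : V →ₗ[𝕜] V)

/-- The bracket `B` at `w` comes from a nondegenerate alternating form `ω` on the subspace `T`:
every smooth `f` has a Hamiltonian vector at `w`, it lies in `T`, and `ω (X_f, X_h) = {f, h}`. -/
def IsNondegenerateOn (B : (V → 𝕜) → (V → 𝕜) → V → 𝕜) (w : V) (T : Submodule 𝕜 V) : Prop :=
  (∀ f, IsSmooth f → ∃ v ∈ T, IsHamiltonianVector B f w v) ∧
  ∃ ω : LinearMap.BilinForm 𝕜 T, ω.IsAlt ∧ ω.Nondegenerate ∧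
    ∀ (f h : V → 𝕜) (u v : T), IsSmooth f → IsSmooth h → IsHamiltonianVector B f w u →
      IsHamiltonianVector B h w v → ω u v = B f h w

/-- `N` is an embedded integral submanifold of the Hamiltonian vector fields (its tangent spaces are
spanned by them), on which the bracket is nondegenerate. No connectedness is required. -/
def IsSymplecticSubmanifold (B : (V → 𝕜) → (V → 𝕜) → V → 𝕜) (N : Set V) : Prop :=
  ∀ w ∈ N, IsSubmanifoldAt N w (hamiltonianSpan B w) ∧
    IsNondegenerateOn B w (hamiltonianSpan B w)

end Poisson

/-! ### The Kirillov bracket and its reductions -/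

section Lie

variable {𝕜 g : Type*} [RCLike 𝕜] [NormedLieRing g] [NormedLieAlgebra 𝕜 g]

/-- `t₀, t₊, t₋` are the images of the standard generators under a homomorphism `sl₂ → g`
(an embedding, or the trivial one `t₀ = t₊ = t₋ = 0`). -/
structure IsSl2Embedding (t0 tp tm : g) : Prop where
  lie_zero_plus : ⁅t0, tp⁆ = tp
  lie_zero_minus : ⁅t0, tm⁆ = -tm
  lie_plus_minus : ⁅tp, tm⁆ = (2 : ℕ) • t0

variable (𝕜) in
/-- The space `g_lw = ker (ad t₋)` of lowest weight vectors. -/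
abbrev lowestWeight (tm : g) : Submodule 𝕜 g := LinearMap.ker (LieAlgebra.ad 𝕜 g tm)

section FiniteDim

variable [FiniteDimensional 𝕜 g]

variable (𝕜) in
/-- The (connected) adjoint group, generated by the exponentials `exp (ad a)`. -/
def adjointGroup (g : Type*) [NormedLieRing g] [NormedLieAlgebra 𝕜 g] [FiniteDimensional 𝕜 g] :
    Subgroup (g →L[𝕜] g)ˣ :=
  Subgroup.closure {u | ∃ a : g, (u : g →L[𝕜] g) =
    NormedSpace.exp (LinearMap.toContinuousLinearMap (LieAlgebra.ad 𝕜 g a))}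

variable (𝕜) in
/-- The (co)adjoint orbit of `x`; the Killing form identifies `g` with its dual. -/
def adjointOrbit (x : g) : Set g := {y | ∃ u ∈ adjointGroup 𝕜 g, y = (u : g →L[𝕜] g) x}

variable [LieAlgebra.IsKilling 𝕜 g]

/-- The gradient of `F` at `x` with respect to the Killing form. -/
def grad (F : g → 𝕜) (x : g) : g :=
  ((killingForm 𝕜 g).toDual (LieAlgebra.IsKilling.killingForm_nondegenerate 𝕜 g)).symm
    (fderiv 𝕜 F x : g →ₗ[𝕜] 𝕜)

/-- The Kirillov bracket `{F, G}(x) = (x, [grad_x F, grad_x G])`. -/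
def kirillov (F G : g → 𝕜) (x : g) : 𝕜 := killingForm 𝕜 g x ⁅grad F x, grad G x⁆

variable (𝕜) in
/-- The index set of the constraints: there are `dim g - dim g_lw` of them. -/
abbrev ConstraintIndex (tm : g) : Type :=
  Fin (Module.finrank 𝕜 (g ⧸ lowestWeight 𝕜 tm))

variable (𝕜) in
/-- The full set of constraints (including the gauge fixing): the linear coordinates of `x - t₊`
modulo `g_lw`. The common zero set is the slice `t₊ + g_lw`. -/
def constraint (tp tm : g) (i : ConstraintIndex 𝕜 tm) (x : g) : 𝕜 :=
  (Module.finBasis 𝕜 (g ⧸ lowestWeight 𝕜 tm)).coord i ((lowestWeight 𝕜 tm).mkQ (x - tp))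

variable (𝕜) in
/-- The matrix `{φ^i, φ^j}(x)` of Kirillov brackets of the constraints. -/
def constraintMatrix (tp tm : g) (x : g) :
    Matrix (ConstraintIndex 𝕜 tm) (ConstraintIndex 𝕜 tm) 𝕜 :=
  Matrix.of fun i j => kirillov (constraint 𝕜 tp tm i) (constraint 𝕜 tp tm j) x

/-- The Dirac bracket `{F, G} - {F, φ^i} Δ_{ij} {φ^j, G}` with `Δ` the inverse of the
matrix `{φ^i, φ^j}`. -/
def diracBracket (tp tm : g) (F G : g → 𝕜) (x : g) : 𝕜 :=
  kirillov F G x - ∑ i, ∑ j, kirillov F (constraint 𝕜 tp tm i) x *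
    (constraintMatrix 𝕜 tp tm x)⁻¹ i j * kirillov (constraint 𝕜 tp tm j) G x

/-- An extension to `g` of a function on `g_lw`, the latter being identified with the slice
`t₊ + g_lw` by `w ↦ t₊ + w`. -/
def extend (tp tm : g) (Q : lowestWeight 𝕜 tm → 𝕜) (x : g) : 𝕜 :=
  Q (Submodule.projectionOnto _ _ (Submodule.exists_isCompl (lowestWeight 𝕜 tm)).choose_spec
    (x - tp))

/-- The bracket of the finite `W` algebra: the Dirac bracket on the functions on `g_lw`, that is, on
the slice `t₊ + g_lw`. -/
def wBracket (tp tm : g) (Q₁ Q₂ : lowestWeight 𝕜 tm → 𝕜) (w : lowestWeight 𝕜 tm) : 𝕜 :=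
  diracBracket tp tm (extend tp tm Q₁) (extend tp tm Q₂) (tp + w)

end FiniteDim

variable [FiniteDimensional 𝕜 g]

variable (𝕜) in
/-- The intersection of the orbit of `x` with the slice `t₊ + g_lw`, as a subset of `g_lw`. -/
def orbitSlice (tp tm x : g) : Set (lowestWeight 𝕜 tm) :=
  {w | tp + (w : g) ∈ adjointOrbit 𝕜 x}

end Lie

end FiniteW

end

/-! Everything rests on one transversality statement: if w ∈ g_lw, x = t₊ + w, and a ∈ im(ad t₋) =
g_lw^⊥ satisfies [x, a] ∈ g_lw, then a = 0 (`IsSl2Embedding.eq_zero_of_lie_mem`). It is a fact about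
finite-dimensional sl₂-modules, obtained from weights and the Casimir operator without complete
reducibility.

It follows that the constraint matrix has no kernel on S, that im(ad x) + g_lw = g, and that each
covector α on g_lw has a unique corrected gradient A α ∈ g, which restricts to α under the Killing
form and satisfies [x, A α] ∈ g_lw. The Dirac bracket is then (x, [A dF, A dG]) and the Hamiltonian
vector of F is [x, A dF]. The Jacobi identity reduces to that of g, and the Hamiltonian vectors span
im(ad x) ∩ g_lw, whose dimension transversality gives. Simplicity enters through nondegeneracy of
the Killing form.

The delicate point of (i) is that O ∩ S is embedded and not merely immersed. The key is a rigidity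
statement, `eventually_exists_expAd_eq_of_conj`: an element z near y with ad z similar to ad y lies
in the orbit of y. Similar operators that are close are conjugate by an operator close to 1, and the
trace-form projection of gl(g) onto ad g turns this operator into some exp(ad a). Hence the orbit is
locally the zero set of a submersion. By the same rigidity Hamiltonian curves, which solve a Lax
equation, stay in one orbit. Conversely, the curves of linear Hamiltonians issuing from w fill a
neighbourhood of w in O ∩ S, so leaves are exactly connected components.

For (ii), regular elements are dense in g and their centralizers have dimension rank g. The orbits
through an open piece of S fill an open set of g, so generic points are dense in S too. -/

noncomputable section

namespace FiniteW

/-! ### Weights and the Casimir operator in finite-dimensional sl₂-modules -/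

section Sl2

variable {K V W : Type*} [Field K] [AddCommGroup V] [Module K V] [FiniteDimensional K V]
  [AddCommGroup W] [Module K W] [FiniteDimensional K W]

/-- If `G` intertwines `T'` and `T`, then a vector in the image of `G` killed by `T` is
the image of a vector in the generalized kernel of `T'`. -/
theorem exists_pow_apply_eq_zero_of_intertwining (G : V →ₗ[K] W) (T : Module.End K W)
    (T' : Module.End K V) (hG : ∀ v, T (G v) = G (T' v)) {u : W} (hu : T u = 0) {b : V}
    (hb : G b = u) : ∃ (k : ℕ) (b' : V), (T' ^ k) b' = 0 ∧ G b' = u := by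
  -- Fitting decompositions of both spaces with a common exponent k ≥ 1. The part of `b` in the
  -- range of `T' ^ k` is sent into both the kernel and the range of `T ^ k`, so it contributes
  -- nothing.
  have h1 := T.eventually_isCompl_ker_pow_range_pow
  have h2 := T'.eventually_isCompl_ker_pow_range_pow
  obtain ⟨k, ⟨hk1, hk2⟩, hk⟩ := ((h1.and h2).and (Filter.eventually_ge_atTop 1)).exists
  have hGk : ∀ (n : ℕ) v, (T ^ n) (G v) = G ((T' ^ n) v) := by
    intro n
    induction n with
    | zero => simp
    | succ n ih => intro v; simp [pow_succ, hG, ih]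
  have htop : b ∈ LinearMap.ker (T' ^ k) ⊔ LinearMap.range (T' ^ k) := by
    rw [hk2.sup_eq_top]; trivial
  obtain ⟨b0, hb0, b1, ⟨c, rfl⟩, rfl⟩ := Submodule.mem_sup.mp htop
  refine ⟨k, b0, hb0, ?_⟩
  have hu' : (T ^ k) u = 0 := by
    obtain ⟨n, rfl⟩ : ∃ n, k = n + 1 := ⟨k - 1, by omega⟩
    simp [pow_succ, hu]
  have hmem : G ((T' ^ k) c) ∈ LinearMap.ker (T ^ k) ⊓ LinearMap.range (T ^ k) := by
    refine ⟨?_, ⟨G c, hGk k c⟩⟩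
    have : G ((T' ^ k) c) = u - G b0 := by rw [← hb]; simp
    rw [SetLike.mem_coe, LinearMap.mem_ker, this, map_sub, hu', hGk, LinearMap.mem_ker.mp hb0]
    simp
  rw [hk1.inf_eq_bot, Submodule.mem_bot] at hmem
  rw [← hb, map_add, hmem, add_zero]

/-- Operators satisfying the relations of the standard generators of `sl₂`. -/
structure IsSl2Ops (E F H : Module.End K V) : Prop where
  ef : ∀ v, E (F v) = F (E v) + H v
  he : ∀ v, H (E v) = E (H v) + (2 : K) • E v
  hf : ∀ v, H (F v) = F (H v) - (2 : K) • F v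

namespace IsSl2Ops

variable {E F H : Module.End K V} (h : IsSl2Ops E F H)
include h

omit [FiniteDimensional K V] in
theorem H_F_pow (n : ℕ) (v : V) :
    H ((F ^ n) v) = (F ^ n) (H v) - (2 * n : K) • (F ^ n) v := by
  induction n generalizing v with
  | zero => simp
  | succ n ih =>
    rw [pow_succ', Module.End.mul_apply, h.hf, ih]
    simp only [Module.End.mul_apply, map_sub, map_smul]
    push_cast
    module

omit [FiniteDimensional K V] in
theorem E_F_pow (n : ℕ) (v : V) :
    (F ^ (n + 1)) (E v) =
      E ((F ^ (n + 1)) v) - (n + 1 : K) • (H ((F ^ n) v) + (n : K) • (F ^ n) v) := by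
  induction n generalizing v with
  | zero => simp [h.ef]
  | succ n ih =>
    rw [pow_succ', Module.End.mul_apply, ih]
    rw [Module.End.mul_apply, h.ef]
    have h2 := h.hf ((F ^ n) v)
    have h3 : (F ^ (n + 1)) v = F ((F ^ n) v) := by rw [pow_succ', Module.End.mul_apply]
    simp only [map_sub, map_add, map_smul]
    rw [h3, h2]
    push_cast
    module

/-- Each nonzero power F^n is an eigenvector of [H, ·] on End V with eigenvalue -2n, and in
characteristic zero there is room for only finitely many of these. -/
theorem isNilpotent_F [CharZero K] : IsNilpotent F := by
  by_contra hF
  have hne : ∀ n, F ^ n ≠ 0 := fun n hn => hF ⟨n, hn⟩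
  let A : Module.End K (Module.End K V) := LinearMap.mulLeft K H - LinearMap.mulRight K H
  have hA : ∀ n : ℕ, A.HasEigenvalue (-(2 * n : K)) := by
    intro n
    refine Module.End.hasEigenvalue_of_hasEigenvector (x := F ^ n) ⟨?_, hne n⟩
    rw [Module.End.mem_eigenspace_iff]
    ext v
    simp only [A, LinearMap.mulLeft_apply, LinearMap.mulRight_apply, LinearMap.sub_apply,
      Module.End.mul_apply,
      LinearMap.smul_apply, h.H_F_pow]
    module
  have hfin := Module.End.finite_hasEigenvalue A
  have hinj : Function.Injective (fun n : ℕ => -(2 * n : K)) := by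
    intro a b hab
    simpa using hab
  exact Set.infinite_of_injective_forall_mem hinj hA hfin

/-- A lowest weight vector of weight `-m` is not in the image of `F ^ (m + 1)`. -/
theorem eq_zero_of_lowestWeight [CharZero K] (m : ℕ) {u b : V} (hFu : F u = 0)
    (hHu : H u + (m : K) • u = 0) (hb : (F ^ (m + 1)) b = u) : u = 0 := by
  by_contra hu
  -- The Casimir operator, and its value `c` on a lowest weight vector of weight -m.
  let C : Module.End K V := (4 : K) • F * E + H * H + (2 : K) • H
  let c : K := m * (m + 2)
  have hC : ∀ v, C v = (4 : K) • F (E v) + H (H v) + (2 : K) • H v := fun v => by simp [C]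
  have hCF : ∀ v, C (F v) = F (C v) := by
    intro v
    simp only [hC, h.ef, h.hf, map_add, map_sub, map_smul]
    module
  have hCH : ∀ v, C (H v) = H (C v) := by
    intro v
    simp only [hC, h.hf, h.he, map_add, map_smul]
    module
  have hCE : ∀ v, C (E v) = E (C v) := by
    intro v
    simp only [hC, h.ef, h.he, map_add, map_smul]
    module
  have hHu' : H u = -(m : K) • u := by rw [neg_smul]; exact eq_neg_of_add_eq_zero_left hHu
  have hCu : (C - algebraMap K _ c) u = 0 := by
    have hFE : F (E u) = (m : K) • u := by
      have := h.ef u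
      rw [hFu, map_zero, hHu'] at this
      rw [← add_zero ((m : K) • u), this]; module
    simp only [LinearMap.sub_apply, hC, Module.algebraMap_end_apply, hHu', hFE, map_smul, c]
    module
  let T : Module.End K V := C - algebraMap K _ c
  have hT : ∀ v, T v = C v - c • v := fun v => by simp [T]
  have hcomm : ∀ (S : Module.End K V), (∀ v, C (S v) = S (C v)) → Commute T S := by
    intro S hS
    ext v
    simp [hT, hS]
  -- The preimage of `u` may be taken in the generalized `c`-eigenspace `p` of the Casimir operator,
  -- which is a submodule.
  obtain ⟨k, b1, hb1, hb1u⟩ := exists_pow_apply_eq_zero_of_intertwining (F ^ (m + 1)) T T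
    (fun v => by
      have := ((hcomm F hCF).pow_right (m + 1)).eq
      simpa using congrArg (fun f : Module.End K V => f v) this) hCu hb
  let p : Submodule K V := LinearMap.ker (T ^ k)
  have hinv : ∀ S : Module.End K V, (∀ v, C (S v) = S (C v)) → ∀ v ∈ p, S v ∈ p := by
    intro S hS v hv
    have := ((hcomm S hS).pow_left k).eq
    have h2 := congrArg (fun f : Module.End K V => f v) this
    simp only [Module.End.mul_apply] at h2
    rw [LinearMap.mem_ker, h2, LinearMap.mem_ker.mp hv, map_zero]
  let Hp : Module.End K p := H.restrict (hinv H hCH)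
  -- `F ^ (m + 1)` lowers weights by 2m + 2, so the preimage of a vector of weight -m may be taken
  -- of generalized weight m + 2.
  obtain ⟨l, b2, hb2, hb2u⟩ := exists_pow_apply_eq_zero_of_intertwining
    ((F ^ (m + 1)).domRestrict p) (H + algebraMap K _ (m : K))
    (Hp - algebraMap K _ (m + 2 : K))
    (fun v => by
      simp only [LinearMap.add_apply, Module.algebraMap_end_apply, LinearMap.domRestrict_apply,
        h.H_F_pow, LinearMap.sub_apply, map_sub, map_smul, Hp, LinearMap.restrict_apply]
      push_cast
      module) (u := u)
    (by simp only [LinearMap.add_apply, Module.algebraMap_end_apply, hHu]) (b := ⟨b1, hb1⟩) hb1u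
  have hb2ne : b2 ≠ 0 := by
    rintro rfl
    exact hu (by rw [← hb2u, map_zero])
  have hev0 : Hp.HasEigenvalue (m + 2 : K) := by
    apply Module.End.hasEigenvalue_of_hasGenEigenvalue (k := l)
    intro hbot
    apply hb2ne
    rw [← Submodule.mem_bot K, ← hbot, Module.End.mem_genEigenspace_nat]
    exact hb2
  -- Raising by `E` must stop. The largest weight M = m + 2 + 2j gives a vector of `p` killed by
  -- `E`, with Casimir value M(M + 2) > m(m + 2). This is impossible on `p`, where `T` is nilpotent.
  let J : Set ℕ := {j | Hp.HasEigenvalue (m + 2 + 2 * j : K)}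
  have hJ0 : (0 : ℕ) ∈ J := by simpa [J] using hev0
  have hJfin : J.Finite := by
    refine Set.Finite.preimage (f := fun j : ℕ => (m + 2 + 2 * j : K)) ?_
      (Module.End.finite_hasEigenvalue Hp)
    intro a _ b _ hab
    simpa using hab
  obtain ⟨j, hj, hjmax⟩ := hJfin.exists_maximal ⟨0, hJ0⟩
  obtain ⟨v, hv, hvne⟩ := Module.End.HasEigenvalue.exists_hasEigenvector hj
  set M : K := m + 2 + 2 * j with hM
  have hHv : H v = M • (v : V) := by
    have := congrArg Subtype.val (Module.End.mem_eigenspace_iff.mp hv)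
    simpa [Hp] using this
  have hEv : E v = 0 := by
    by_contra hne
    have hmem : (⟨E v, hinv E hCE v v.2⟩ : p) ≠ 0 := by
      intro h0; exact hne (congrArg Subtype.val h0)
    have hj1 : j + 1 ∈ J := by
      refine Module.End.hasEigenvalue_of_hasEigenvector (x := ⟨E v, hinv E hCE v v.2⟩) ⟨?_, hmem⟩
      rw [Module.End.mem_eigenspace_iff]
      apply Subtype.ext
      simp only [Hp, LinearMap.restrict_apply, h.he, hHv, map_smul, Submodule.coe_smul, hM]
      push_cast
      module
    have := hjmax hj1 (by omega)
    omega
  have hCv : T v = (M * (M + 2) - c) • (v : V) := by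
    simp only [hT, hC, hEv, hHv, map_smul, map_zero]
    module
  have hTk : ∀ n : ℕ, (T ^ n) v = ((M * (M + 2) - c) ^ n) • (v : V) := by
    intro n
    induction n with
    | zero => simp
    | succ n ih => rw [pow_succ, Module.End.mul_apply, hCv, map_smul, ih, smul_smul, pow_succ']
  have hzero := hTk k
  rw [LinearMap.mem_ker.mp v.2, eq_comm, smul_eq_zero] at hzero
  have hvne' : (v : V) ≠ 0 := by simpa using hvne
  have h1 : M * (M + 2) - c = 0 := by
    rcases hzero with h | h
    · exact eq_zero_of_pow_eq_zero h
    · exact absurd h hvne'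
  have h2 : (((m + 2 + 2 * j) * (m + 2 + 2 * j + 2) : ℕ) : K) = ((m * (m + 2) : ℕ) : K) := by
    push_cast
    rw [sub_eq_zero] at h1
    simpa [hM, c] using h1
  have h3 := Nat.cast_injective (R := K) h2
  nlinarith

/-- `E + W` maps the image of `F` transversally to the kernel of `F` when `W` commutes with `F`. -/
theorem eq_zero_of_transversal [CharZero K] {W : Module.End K V} (hW : ∀ v, F (W v) = W (F v))
    {b : V} (hb : F (E (F b) + W (F b)) = 0) : F b = 0 := by
  obtain ⟨N, hN⟩ := h.isNilpotent_F
  -- If F^(n+2) b = 0, applying F^n to the hypothesis kills the `W` term and leaves (H + n) F^(n+1)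
  -- b = 0. So F^(n+1) b is a lowest weight vector of weight -n in the image of F^(n+1), hence zero,
  -- and the exponent drops by one.
  have key : ∀ n : ℕ, (F ^ (n + 1)) b = 0 → F b = 0 := by
    intro n
    induction n with
    | zero => intro h0; simpa using h0
    | succ n ih =>
      intro hn
      apply ih
      have hWn : ∀ (n : ℕ) v, (F ^ n) (W v) = W ((F ^ n) v) := by
        intro n
        induction n with
        | zero => simp
        | succ n ih => intro v; simp [pow_succ, hW, ih]
      have hFn : ∀ (n : ℕ) v, (F ^ n) (F v) = (F ^ (n + 1)) v := fun n v => by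
        rw [pow_succ, Module.End.mul_apply]
      have h1 : (F ^ (n + 1)) (E (F b)) = 0 := by
        have h2 : (F ^ (n + 1)) (E (F b) + W (F b)) = 0 := by
          rw [pow_succ, Module.End.mul_apply, hb, map_zero]
        rw [map_add, hWn, hFn, hn, map_zero, add_zero] at h2
        exact h2
      rw [h.E_F_pow, hFn, hFn, hn, map_zero, zero_sub, neg_eq_zero,
        smul_eq_zero] at h1
      have h2 := h1.resolve_left (Nat.cast_add_one_ne_zero n)
      refine h.eq_zero_of_lowestWeight n ?_ h2 rfl
      rw [← Module.End.mul_apply, ← pow_succ', hn]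
  apply key N
  rw [pow_succ', hN, mul_zero, LinearMap.zero_apply]

end IsSl2Ops

end Sl2

/-! ### Transversality of the slice and the Dirac bracket -/

section Slice

variable {𝕜 g : Type*} [RCLike 𝕜] [NormedLieRing g] [NormedLieAlgebra 𝕜 g]
  [FiniteDimensional 𝕜 g]

omit [FiniteDimensional 𝕜 g] in
theorem killingForm_comm (x y : g) : killingForm 𝕜 g x y = killingForm 𝕜 g y x :=
  LieModule.traceForm_comm 𝕜 g g x y

omit [FiniteDimensional 𝕜 g] in
theorem killingForm_lie (x y z : g) : killingForm 𝕜 g ⁅x, y⁆ z = killingForm 𝕜 g x ⁅y, z⁆ :=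
  LieModule.traceForm_apply_lie_apply 𝕜 g g x y z

section Transversality

variable {t0 tp tm : g} (ht : IsSl2Embedding t0 tp tm)
include ht

omit [FiniteDimensional 𝕜 g] in
-- With [t₀, t±] = ±t±, the element t₀ is half the usual Cartan generator, whence the factor 2.
theorem IsSl2Embedding.isSl2Ops :
    IsSl2Ops (LieAlgebra.ad 𝕜 g tp) (LieAlgebra.ad 𝕜 g tm) (LieAlgebra.ad 𝕜 g ((2 : 𝕜) • t0)) where
  ef v := by
    have := ht.lie_plus_minus
    simp only [LieAlgebra.ad_apply, leibniz_lie tp, this, two_smul]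
    abel
  he v := by
    simp only [LieAlgebra.ad_apply, leibniz_lie ((2 : 𝕜) • t0) tp, smul_lie, ht.lie_zero_plus,
      lie_smul]
    abel
  hf v := by
    simp only [LieAlgebra.ad_apply, leibniz_lie ((2 : 𝕜) • t0) tm, smul_lie, ht.lie_zero_minus,
      lie_smul, neg_lie, smul_neg]
    abel

/-- The slice is transversal to `[x, im (ad t₋)]`, on which `ad x` is injective. -/
theorem IsSl2Embedding.eq_zero_of_lie_mem {w a : g} (hw : w ∈ lowestWeight 𝕜 tm)
    (ha : a ∈ LinearMap.range (LieAlgebra.ad 𝕜 g tm))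
    (hxa : ⁅tp + w, a⁆ ∈ lowestWeight 𝕜 tm) : a = 0 := by
  obtain ⟨b, rfl⟩ := ha
  refine (ht.isSl2Ops (𝕜 := 𝕜)).eq_zero_of_transversal (W := LieAlgebra.ad 𝕜 g w) ?_ (b := b) ?_
  · intro v
    have : ⁅tm, w⁆ = 0 := hw
    simp only [LieAlgebra.ad_apply, leibniz_lie tm w v, this, zero_lie, zero_add]
  · have : ⁅tm, ⁅tp + w, LieAlgebra.ad 𝕜 g tm b⁆⁆ = 0 := hxa
    rw [add_lie] at this
    simpa only [LieAlgebra.ad_apply] using this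

end Transversality

variable [LieAlgebra.IsKilling 𝕜 g]

/-- The orthogonal complement of `ker (ad t)` for the Killing form is the image of `ad t`. -/
theorem orthogonal_lowestWeight (t : g) :
    LinearMap.BilinForm.orthogonal (killingForm 𝕜 g) (lowestWeight 𝕜 t) =
      LinearMap.range (LieAlgebra.ad 𝕜 g t) := by
  symm
  apply Submodule.eq_of_le_of_finrank_eq
  · rintro _ ⟨b, rfl⟩ v hv
    have hv' : ⁅t, v⁆ = 0 := hv
    change killingForm 𝕜 g v ⁅t, b⁆ = 0
    rw [← killingForm_lie, ← lie_skew, hv', neg_zero, map_zero, LinearMap.zero_apply]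
  · have h1 := LinearMap.BilinForm.finrank_orthogonal
      (LieAlgebra.IsKilling.killingForm_nondegenerate 𝕜 g) (lowestWeight 𝕜 t)
    have h2 : _ + Module.finrank 𝕜 (lowestWeight 𝕜 t) = _ :=
      LinearMap.finrank_range_add_finrank_ker (LieAlgebra.ad 𝕜 g t)
    omega

theorem mem_range_ad_of_orthogonal {t a : g}
    (ha : ∀ v ∈ lowestWeight 𝕜 t, killingForm 𝕜 g a v = 0) :
    a ∈ LinearMap.range (LieAlgebra.ad 𝕜 g t) := by
  rw [← orthogonal_lowestWeight]
  intro v hv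
  change killingForm 𝕜 g v a = 0
  rw [killingForm_comm, ha v hv]

theorem mem_lowestWeight_of_orthogonal {t a : g}
    (ha : ∀ v ∈ LinearMap.range (LieAlgebra.ad 𝕜 g t), killingForm 𝕜 g v a = 0) :
    a ∈ lowestWeight 𝕜 t := by
  have h := LinearMap.BilinForm.orthogonal_orthogonal
    (LieAlgebra.IsKilling.killingForm_nondegenerate 𝕜 g)
    (LieModule.traceForm_isSymm 𝕜 g g).isRefl (lowestWeight 𝕜 t)
  rw [← h, orthogonal_lowestWeight]
  exact ha

theorem killingForm_grad (F : g → 𝕜) (x v : g) :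
    killingForm 𝕜 g (grad F x) v = fderiv 𝕜 F x v := by
  unfold grad
  rw [LinearMap.BilinForm.apply_toDual_symm_apply]
  rfl

omit [FiniteDimensional 𝕜 g] in
theorem eq_of_killingForm_eq {a b : g} (h : ∀ v, killingForm 𝕜 g a v = killingForm 𝕜 g b v) :
    a = b := by
  have := (LieAlgebra.IsKilling.killingForm_nondegenerate 𝕜 g).1 (a - b)
    (fun v => by rw [map_sub, LinearMap.sub_apply, h v, sub_self])
  exact sub_eq_zero.mp this

/-! ### The constraints -/

/-- The constraints are affine, so their gradients do not depend on the point; they form a basis of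
g_lw^⊥, as the next two lemmas show. -/
theorem killingForm_grad_constraint (tp tm : g) (i : ConstraintIndex 𝕜 tm) (x v : g) :
    killingForm 𝕜 g (grad (constraint 𝕜 tp tm i) x) v =
      (Module.finBasis 𝕜 (g ⧸ lowestWeight 𝕜 tm)).coord i ((lowestWeight 𝕜 tm).mkQ v) := by
  rw [killingForm_grad]
  let l : g →L[𝕜] 𝕜 := LinearMap.toContinuousLinearMap
    ((Module.finBasis 𝕜 (g ⧸ lowestWeight 𝕜 tm)).coord i ∘ₗ (lowestWeight 𝕜 tm).mkQ)
  have : HasFDerivAt (constraint 𝕜 tp tm i) l x :=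
    l.hasFDerivAt.comp x ((hasFDerivAt_id x).sub_const tp)
  rw [this.fderiv]
  rfl

theorem exists_eq_sum_grad_constraint (tp : g) {tm a : g}
    (ha : ∀ v ∈ lowestWeight 𝕜 tm, killingForm 𝕜 g a v = 0) (x : g) :
    ∃ c : ConstraintIndex 𝕜 tm → 𝕜, a = ∑ i, c i • grad (constraint 𝕜 tp tm i) x := by
  let b := Module.finBasis 𝕜 (g ⧸ lowestWeight 𝕜 tm)
  let l : (g ⧸ lowestWeight 𝕜 tm) →ₗ[𝕜] 𝕜 := (lowestWeight 𝕜 tm).liftQ (killingForm 𝕜 g a) ha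
  refine ⟨fun i => l (b i), eq_of_killingForm_eq (𝕜 := 𝕜) fun v => ?_⟩
  rw [map_sum, LinearMap.sum_apply]
  simp only [map_smul, LinearMap.smul_apply, killingForm_grad_constraint]
  have h1 : killingForm 𝕜 g a v = l ((lowestWeight 𝕜 tm).mkQ v) := rfl
  rw [h1]
  conv_lhs => rw [← b.sum_repr ((lowestWeight 𝕜 tm).mkQ v)]
  rw [map_sum]
  refine Finset.sum_congr rfl fun i _ => ?_
  rw [map_smul, smul_eq_mul, smul_eq_mul, mul_comm]
  rfl

theorem sum_smul_grad_constraint_eq_zero {tp tm x : g} {c : ConstraintIndex 𝕜 tm → 𝕜}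
    (hc : ∑ i, c i • grad (constraint 𝕜 tp tm i) x = 0) : c = 0 := by
  funext j
  obtain ⟨v, hv⟩ := (lowestWeight 𝕜 tm).mkQ_surjective
    (Module.finBasis 𝕜 (g ⧸ lowestWeight 𝕜 tm) j)
  have := congrArg (fun a => killingForm 𝕜 g a v) hc
  simp only [map_sum, LinearMap.sum_apply, map_smul, LinearMap.smul_apply,
    killingForm_grad_constraint, hv, map_zero, LinearMap.zero_apply] at this
  simpa [Finsupp.single_apply] using this

theorem killingForm_grad_constraint_of_mem (tp : g) {tm v : g} (hv : v ∈ lowestWeight 𝕜 tm)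
    (i : ConstraintIndex 𝕜 tm) (x : g) :
    killingForm 𝕜 g (grad (constraint 𝕜 tp tm i) x) v = 0 := by
  rw [killingForm_grad_constraint, Submodule.mkQ_apply, (Submodule.Quotient.mk_eq_zero _).mpr hv,
    map_zero]

omit [FiniteDimensional 𝕜 g] [LieAlgebra.IsKilling 𝕜 g] in
theorem killingForm_lie_skew (x a b : g) : killingForm 𝕜 g x ⁅a, b⁆ =
    - killingForm 𝕜 g x ⁅b, a⁆ := by
  rw [← lie_skew, map_neg]

omit [FiniteDimensional 𝕜 g] [LieAlgebra.IsKilling 𝕜 g] in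
theorem killingForm_lie_self (x a : g) : killingForm 𝕜 g x ⁅a, a⁆ = 0 := by
  rw [lie_self, map_zero]

variable {t0 tp tm : g} (ht : IsSl2Embedding t0 tp tm)
include ht

theorem IsSl2Embedding.eq_zero_of_orthogonal {w a : g} (hw : w ∈ lowestWeight 𝕜 tm)
    (ha : ∀ v ∈ lowestWeight 𝕜 tm, killingForm 𝕜 g a v = 0)
    (hxa : ⁅tp + w, a⁆ ∈ lowestWeight 𝕜 tm) : a = 0 :=
  ht.eq_zero_of_lie_mem hw (mem_range_ad_of_orthogonal ha) hxa

/-- A kernel vector `e` yields m = Σ eᵢ grad φⁱ in g_lw^⊥ with [x, m] orthogonal to g_lw^⊥, that is,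
in g_lw. Transversality gives m = 0, and the gradients are independent. -/
theorem isUnit_constraintMatrix (w : lowestWeight 𝕜 tm) :
    IsUnit (constraintMatrix 𝕜 tp tm (tp + (w : g))) := by
  rw [← Matrix.mulVec_injective_iff_isUnit]
  intro c d hcd
  rw [← sub_eq_zero]
  have h0 : (constraintMatrix 𝕜 tp tm (tp + (w : g))).mulVec (c - d) = 0 := by
    rw [Matrix.mulVec_sub]; exact sub_eq_zero.mpr hcd
  set e := c - d
  set x := tp + (w : g)
  apply sum_smul_grad_constraint_eq_zero (tp := tp) (x := x)
  set m := ∑ i, e i • grad (constraint 𝕜 tp tm i) x with hm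
  refine ht.eq_zero_of_orthogonal w.2 ?_ ?_
  · intro v hv
    rw [hm, map_sum, LinearMap.sum_apply]
    refine Finset.sum_eq_zero fun i _ => ?_
    rw [map_smul, LinearMap.smul_apply, killingForm_grad_constraint_of_mem tp hv, smul_zero]
  · have horth : ∀ i, killingForm 𝕜 g x ⁅grad (constraint 𝕜 tp tm i) x, m⁆ = 0 := by
      intro i
      have := congrFun h0 i
      rw [hm, lie_sum, map_sum]
      rw [Matrix.mulVec, dotProduct] at this
      rw [← Pi.zero_apply (M := fun _ => 𝕜) i, ← this]
      refine Finset.sum_congr rfl fun j _ => ?_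
      rw [lie_smul, map_smul, smul_eq_mul, mul_comm]
      rfl
    apply mem_lowestWeight_of_orthogonal
    rintro v hv
    have hv' : ∀ u ∈ lowestWeight 𝕜 tm, killingForm 𝕜 g v u = 0 := by
      rw [← orthogonal_lowestWeight] at hv
      intro u hu
      rw [killingForm_comm]
      exact hv u hu
    obtain ⟨c', rfl⟩ := exists_eq_sum_grad_constraint tp hv' x
    rw [map_sum, LinearMap.sum_apply]
    refine Finset.sum_eq_zero fun i _ => ?_
    rw [map_smul, LinearMap.smul_apply, killingForm_comm, killingForm_lie, ← lie_skew, map_neg,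
      horth, neg_zero, smul_zero]

/-- The Dirac bracket computed with corrected gradients. -/
theorem diracBracket_eq (w : lowestWeight 𝕜 tm) {F G : g → 𝕜} {a b : g}
    (ha : ∀ v ∈ lowestWeight 𝕜 tm, killingForm 𝕜 g a v = fderiv 𝕜 F (tp + (w : g)) v)
    (hxa : ⁅tp + (w : g), a⁆ ∈ lowestWeight 𝕜 tm)
    (hb : ∀ v ∈ lowestWeight 𝕜 tm, killingForm 𝕜 g b v = fderiv 𝕜 G (tp + (w : g)) v)
    (hxb : ⁅tp + (w : g), b⁆ ∈ lowestWeight 𝕜 tm) :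
    diracBracket tp tm F G (tp + w) = killingForm 𝕜 g (tp + w) ⁅a, b⁆ := by
  set x := tp + (w : g) with hx
  let β := fun i => grad (constraint 𝕜 tp tm i) x
  have hperp : ∀ {c : g}, ⁅x, c⁆ ∈ lowestWeight 𝕜 tm → ∀ i,
      killingForm 𝕜 g x ⁅c, β i⁆ = 0 := by
    intro c hc i
    rw [← killingForm_lie, killingForm_comm]
    exact killingForm_grad_constraint_of_mem tp hc i x
  -- A gradient and its corrected version agree on g_lw, so they differ by constraint gradients,
  -- which pair to zero with `a` and `b` by `hperp`.
  obtain ⟨c, hc⟩ := exists_eq_sum_grad_constraint (𝕜 := 𝕜) tp (tm := tm) (a := grad F x - a)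
    (fun v hv => by rw [map_sub, LinearMap.sub_apply, ha v hv, killingForm_grad, sub_self]) x
  obtain ⟨d, hd⟩ := exists_eq_sum_grad_constraint (𝕜 := 𝕜) tp (tm := tm) (a := grad G x - b)
    (fun v hv => by rw [map_sub, LinearMap.sub_apply, hb v hv, killingForm_grad, sub_self]) x
  set Δ := constraintMatrix 𝕜 tp tm x with hΔ
  have hunit : IsUnit Δ := isUnit_constraintMatrix ht w
  have hΔij : ∀ i j, killingForm 𝕜 g x ⁅β i, β j⁆ = Δ i j := fun i j => rfl
  have hFG : grad F x = a + ∑ i, c i • β i := by rw [← hc]; abel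
  have hGG : grad G x = b + ∑ i, d i • β i := by rw [← hd]; abel
  have hl : ∀ i, kirillov F (constraint 𝕜 tp tm i) x = Matrix.vecMul c Δ i := by
    intro i
    change killingForm 𝕜 g x ⁅grad F x, β i⁆ = _
    rw [hFG, add_lie, map_add, hperp hxa i, zero_add, sum_lie, map_sum]
    refine Finset.sum_congr rfl fun j _ => ?_
    rw [smul_lie, map_smul, hΔij, smul_eq_mul]
  have hr : ∀ i, kirillov (constraint 𝕜 tp tm i) G x = Matrix.mulVec Δ d i := by
    intro i
    change killingForm 𝕜 g x ⁅β i, grad G x⁆ = _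
    rw [hGG, lie_add, map_add, killingForm_lie_skew x (β i) b, hperp hxb i, neg_zero,
      zero_add, lie_sum, map_sum]
    refine Finset.sum_congr rfl fun j _ => ?_
    rw [lie_smul, map_smul, hΔij, smul_eq_mul, mul_comm]
  have hmid : kirillov F G x = killingForm 𝕜 g x ⁅a, b⁆ + dotProduct c (Matrix.mulVec Δ d) := by
    change killingForm 𝕜 g x ⁅grad F x, grad G x⁆ = _
    have h1 : killingForm 𝕜 g x ⁅a, ∑ i, d i • β i⁆ = 0 := by
      rw [lie_sum, map_sum]
      refine Finset.sum_eq_zero fun i _ => ?_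
      rw [lie_smul, map_smul, hperp hxa, smul_zero]
    have h2 : killingForm 𝕜 g x ⁅∑ i, c i • β i, grad G x⁆ =
        dotProduct c (Matrix.mulVec Δ d) := by
      rw [sum_lie, map_sum]
      refine Finset.sum_congr rfl fun i _ => ?_
      rw [smul_lie, map_smul, smul_eq_mul, ← hr i]
      rfl
    rw [hFG, add_lie, map_add, h2, hGG, lie_add, map_add, h1, add_zero]
  -- The Dirac correction is (cΔ) Δ⁻¹ (Δd) = c Δ d, exactly the surplus found in `hmid`.
  have hsum : ∑ i, ∑ j, kirillov F (constraint 𝕜 tp tm i) x * Δ⁻¹ i j *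
      kirillov (constraint 𝕜 tp tm j) G x = dotProduct c (Matrix.mulVec Δ d) := by
    have h1 : dotProduct (Matrix.vecMul c Δ) (Matrix.mulVec Δ⁻¹ (Matrix.mulVec Δ d)) =
        dotProduct c (Matrix.mulVec Δ d) := by
      rw [Matrix.mulVec_mulVec, Matrix.nonsing_inv_mul _
          ((Matrix.isUnit_iff_isUnit_det _).mp hunit),
        Matrix.one_mulVec, Matrix.dotProduct_mulVec]
    rw [← h1, dotProduct]
    refine Finset.sum_congr rfl fun i _ => ?_
    rw [Matrix.mulVec, dotProduct, Finset.mul_sum]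
    refine Finset.sum_congr rfl fun j _ => ?_
    rw [hl, hr, mul_assoc]
  unfold diracBracket
  rw [hsum, hmid, add_sub_cancel_right]

omit ht in
omit [LieAlgebra.IsKilling 𝕜 g] in
-- Only derivatives along g_lw enter `diracBracket_eq`, so the complement chosen in `extend` is
-- immaterial.
theorem fderiv_extend (tp : g) {Q : lowestWeight 𝕜 tm → 𝕜} {w : lowestWeight 𝕜 tm}
    (hQ : DifferentiableAt 𝕜 Q w) (v : lowestWeight 𝕜 tm) :
    fderiv 𝕜 (extend tp tm Q) (tp + (w : g)) (v : g) = fderiv 𝕜 Q w v := by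
  obtain ⟨P, hP, hQP⟩ : ∃ P : g →L[𝕜] lowestWeight 𝕜 tm,
      (∀ u : lowestWeight 𝕜 tm, P (u : g) = u) ∧ extend tp tm Q = fun x => Q (P (x - tp)) :=
    ⟨LinearMap.toContinuousLinearMap (Submodule.projectionOnto _ _
      (Submodule.exists_isCompl (lowestWeight 𝕜 tm)).choose_spec),
      Submodule.projectionOnto_apply_left _, rfl⟩
  have h1 : HasFDerivAt (fun x : g => P (x - tp)) P (tp + (w : g)) :=
    P.hasFDerivAt.comp _ ((hasFDerivAt_id _).sub_const tp)
  have h0 : P (tp + (w : g) - tp) = w := by rw [add_sub_cancel_left, hP]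
  have h2 : HasFDerivAt (extend tp tm Q) ((fderiv 𝕜 Q w).comp P) (tp + (w : g)) := by
    rw [hQP]
    refine HasFDerivAt.comp (g := Q) _ ?_ h1
    rw [h0]
    exact hQ.hasFDerivAt
  rw [h2.fderiv, ContinuousLinearMap.comp_apply, hP]

end Slice

/-! ### Corrected gradients and the Jacobi identity -/

section Bivector

variable {𝕜 g : Type*} [RCLike 𝕜] [NormedLieRing g] [NormedLieAlgebra 𝕜 g]
  [FiniteDimensional 𝕜 g]

variable (𝕜 g) in
/-- The Lie bracket as a continuous bilinear map. -/
def lieL : g →L[𝕜] g →L[𝕜] g :=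
  LinearMap.toContinuousBilinearMap (LieAlgebra.ad 𝕜 g : g →ₗ[𝕜] g →ₗ[𝕜] g)

@[simp] theorem lieL_apply (x y : g) : lieL 𝕜 g x y = ⁅x, y⁆ := rfl

variable (𝕜 g) in
/-- The Killing form as a continuous bilinear map. -/
def killingL : g →L[𝕜] g →L[𝕜] 𝕜 := LinearMap.toContinuousBilinearMap (killingForm 𝕜 g)

variable (𝕜) in
/-- A smooth family of linear maps `A` that lift covectors on the slice to `g` in such a way that
`[x, A α]` is tangent to the slice at `x`; this tangent vector is `X α`. -/
structure SliceLift (tp tm : g) where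
  A : lowestWeight 𝕜 tm → (lowestWeight 𝕜 tm →L[𝕜] 𝕜) →L[𝕜] g
  X : lowestWeight 𝕜 tm → (lowestWeight 𝕜 tm →L[𝕜] 𝕜) →L[𝕜] lowestWeight 𝕜 tm
  contDiff_A : ContDiff 𝕜 (⊤ : ℕ∞) A
  contDiff_X : ContDiff 𝕜 (⊤ : ℕ∞) X
  killingForm_A : ∀ w α (v : lowestWeight 𝕜 tm), killingForm 𝕜 g (A w α) v = α v
  coe_X : ∀ w α, (X w α : g) = ⁅tp + (w : g), A w α⁆

variable [LieAlgebra.IsKilling 𝕜 g] {t0 tp tm : g}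

/-- The map sending a to ((a, ·) on g_lw, [x, a] mod g_lw) goes between spaces of equal dimension
and is injective by transversality. `A` is its inverse at (α, 0); it is smooth because operator
inversion is. -/
theorem IsSl2Embedding.nonempty_sliceLift (ht : IsSl2Embedding t0 tp tm) :
    Nonempty (SliceLift 𝕜 tp tm) := by
  have : CompleteSpace g := FiniteDimensional.complete 𝕜 g
  obtain ⟨C, hC⟩ := Submodule.exists_isCompl (lowestWeight 𝕜 tm)
  let L := lowestWeight 𝕜 tm
  let πC : g →L[𝕜] C := LinearMap.toContinuousLinearMap (Submodule.projectionOnto C L hC.symm)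
  let πL : g →L[𝕜] L := LinearMap.toContinuousLinearMap (Submodule.projectionOnto L C hC)
  have hπC : ∀ v, πC v = 0 ↔ v ∈ L := fun v => Submodule.projectionOnto_apply_eq_zero_iff hC.symm
  have hπL : ∀ (v : g) (hv : v ∈ L), (πL v : g) = v := fun v hv => by
    have := Submodule.projectionOnto_apply_left hC ⟨v, hv⟩
    exact congrArg Subtype.val this
  let K1 : g →L[𝕜] (L →L[𝕜] 𝕜) :=
    (ContinuousLinearMap.compL 𝕜 L g 𝕜).flip L.subtypeL ∘L killingL 𝕜 g
  have hK1 : ∀ a (v : L), K1 a v = killingForm 𝕜 g a v := fun a v => rfl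
  let T : g → g →L[𝕜] ((L →L[𝕜] 𝕜) × C) := fun x =>
    ContinuousLinearMap.inl 𝕜 _ _ ∘L K1 + ContinuousLinearMap.inr 𝕜 _ _ ∘L πC ∘L lieL 𝕜 g x
  have hT : ∀ x a, T x a = (K1 a, πC ⁅x, a⁆) := fun x a => by simp [T]
  have hTsmooth : ContDiff 𝕜 (⊤ : ℕ∞) T := by
    exact contDiff_const.add (contDiff_const.clm_comp
      (contDiff_const.clm_comp (lieL 𝕜 g).contDiff))
  have hrank : Module.finrank 𝕜 g = Module.finrank 𝕜 ((L →L[𝕜] 𝕜) × C) := by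
    rw [Module.finrank_prod,
      (LinearMap.toContinuousLinearMap (𝕜 := 𝕜) (E := L) (F' := 𝕜)).symm.finrank_eq,
      Module.finrank_linearMap, Module.finrank_self, mul_one]
    exact (Submodule.finrank_add_eq_of_isCompl hC).symm
  have hinv : ∀ w : L, ∃ e : g ≃L[𝕜] ((L →L[𝕜] 𝕜) × C),
      (e : g →L[𝕜] ((L →L[𝕜] 𝕜) × C)) = T (tp + (w : g)) := by
    intro w
    have hinj : Function.Injective (T (tp + (w : g)) : g →ₗ[𝕜] ((L →L[𝕜] 𝕜) × C)) := by
      rw [← LinearMap.ker_eq_bot, LinearMap.ker_eq_bot']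
      intro a ha
      have ha' : T (tp + (w : g)) a = 0 := ha
      rw [hT, Prod.mk_eq_zero, hπC] at ha'
      refine ht.eq_zero_of_orthogonal w.2 (fun v hv => ?_) ha'.2
      have := DFunLike.congr_fun ha'.1 ⟨v, hv⟩
      exact this
    refine ⟨(LinearEquiv.ofInjectiveOfFinrankEq _ hinj hrank).toContinuousLinearEquiv, ?_⟩
    ext a <;> rfl
  let A : L → (L →L[𝕜] 𝕜) →L[𝕜] g := fun w =>
    (T (tp + (w : g))).inverse ∘L ContinuousLinearMap.inl 𝕜 _ _
  have hA : ContDiff 𝕜 (⊤ : ℕ∞) A := by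
    rw [contDiff_iff_contDiffAt]
    intro w
    obtain ⟨e, he⟩ := hinv w
    have h1 : ContDiffAt 𝕜 (⊤ : ℕ∞) (fun w : L => T (tp + (w : g))) w :=
      (hTsmooth.comp (contDiff_const.add L.subtypeL.contDiff)).contDiffAt
    have h2 : ContDiffAt 𝕜 (⊤ : ℕ∞) (fun w : L => (T (tp + (w : g))).inverse) w := by
      refine ContDiffAt.comp (g := ContinuousLinearMap.inverse) w ?_ h1
      rw [← he]
      exact contDiffAt_map_inverse e
    exact h2.clm_comp contDiffAt_const
  have hTA : ∀ (w : L) α, T (tp + (w : g)) (A w α) = (α, 0) := by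
    intro w α
    obtain ⟨e, he⟩ := hinv w
    simp only [A, ← he, ContinuousLinearMap.inverse_equiv]
    simp
  have hAmem : ∀ (w : L) α, ⁅tp + (w : g), A w α⁆ ∈ L := by
    intro w α
    rw [← hπC]
    have := hTA w α
    rw [hT] at this
    exact congrArg Prod.snd this
  refine ⟨⟨A, fun w => πL ∘L (lieL 𝕜 g (tp + (w : g))) ∘L A w, hA, ?_, ?_, ?_⟩⟩
  · exact contDiff_const.clm_comp
      (((lieL 𝕜 g).contDiff.comp (contDiff_const.add L.subtypeL.contDiff)).clm_comp hA)
  · intro w α v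
    have := hTA w α
    rw [hT] at this
    rw [← hK1]
    exact DFunLike.congr_fun (congrArg Prod.fst this) v
  · intro w α
    exact hπL _ (hAmem w α)

namespace SliceLift

variable (S : SliceLift 𝕜 tp tm)

omit [FiniteDimensional 𝕜 g] [LieAlgebra.IsKilling 𝕜 g] in
theorem lie_A_mem (w : lowestWeight 𝕜 tm) (α : lowestWeight 𝕜 tm →L[𝕜] 𝕜) :
    ⁅tp + (w : g), S.A w α⁆ ∈ lowestWeight 𝕜 tm := by
  rw [← S.coe_X]; exact (S.X w α).2

omit [FiniteDimensional 𝕜 g] [LieAlgebra.IsKilling 𝕜 g] in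
theorem apply_X (w : lowestWeight 𝕜 tm) (α β : lowestWeight 𝕜 tm →L[𝕜] 𝕜) :
    β (S.X w α) = killingForm 𝕜 g (tp + (w : g)) ⁅S.A w α, S.A w β⁆ := by
  rw [← S.killingForm_A w β, killingForm_comm, S.coe_X, killingForm_lie]

omit [FiniteDimensional 𝕜 g] [LieAlgebra.IsKilling 𝕜 g] in
theorem apply_X_skew (w : lowestWeight 𝕜 tm) (α β : lowestWeight 𝕜 tm →L[𝕜] 𝕜) :
    β (S.X w α) = - α (S.X w β) := by
  rw [apply_X, apply_X, killingForm_lie_skew]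

omit [FiniteDimensional 𝕜 g] [LieAlgebra.IsKilling 𝕜 g] in
theorem apply_X_self (w : lowestWeight 𝕜 tm) (α : lowestWeight 𝕜 tm →L[𝕜] 𝕜) :
    α (S.X w α) = 0 := by
  rw [apply_X, killingForm_lie_self]

/-- The lifts of the two differentials serve as the corrected gradients in `diracBracket_eq`. -/
theorem wBracket_eq (ht : IsSl2Embedding t0 tp tm) {Q₁ Q₂ : lowestWeight 𝕜 tm → 𝕜}
    {w : lowestWeight 𝕜 tm} (h₁ : DifferentiableAt 𝕜 Q₁ w) (h₂ : DifferentiableAt 𝕜 Q₂ w) :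
    wBracket tp tm Q₁ Q₂ w = fderiv 𝕜 Q₂ w (S.X w (fderiv 𝕜 Q₁ w)) := by
  rw [S.apply_X]
  refine diracBracket_eq ht w ?_ (S.lie_A_mem w _) ?_ (S.lie_A_mem w _)
  · intro v hv
    rw [S.killingForm_A w _ ⟨v, hv⟩, ← fderiv_extend tp h₁]
  · intro v hv
    rw [S.killingForm_A w _ ⟨v, hv⟩, ← fderiv_extend tp h₂]

end SliceLift

theorem IsSmooth.differentiable {V : Type*} [NormedAddCommGroup V] [NormedSpace 𝕜 V] {f : V → 𝕜}
    (hf : IsSmooth f) : Differentiable 𝕜 f :=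
  ContDiff.differentiable hf (by simp)

theorem IsSmooth.contDiff_fderiv {V : Type*} [NormedAddCommGroup V] [NormedSpace 𝕜 V] {f : V → 𝕜}
    (hf : IsSmooth f) : ContDiff 𝕜 (⊤ : ℕ∞) (fderiv 𝕜 f) :=
  ContDiff.fderiv_right hf (by simp)

namespace SliceLift

variable (S : SliceLift 𝕜 tp tm)

theorem wBracket_eq_fun (ht : IsSl2Embedding t0 tp tm) {Q₁ Q₂ : lowestWeight 𝕜 tm → 𝕜}
    (h₁ : IsSmooth Q₁) (h₂ : IsSmooth Q₂) :
    wBracket tp tm Q₁ Q₂ = fun w => fderiv 𝕜 Q₂ w (S.X w (fderiv 𝕜 Q₁ w)) :=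
  funext fun w => S.wBracket_eq ht (h₁.differentiable w) (h₂.differentiable w)

omit [FiniteDimensional 𝕜 g] [LieAlgebra.IsKilling 𝕜 g] in
theorem isSmooth_bracket {Q₁ Q₂ : lowestWeight 𝕜 tm → 𝕜}
    (h₁ : IsSmooth Q₁) (h₂ : IsSmooth Q₂) :
    IsSmooth fun w => fderiv 𝕜 Q₂ w (S.X w (fderiv 𝕜 Q₁ w)) :=
  h₂.contDiff_fderiv.clm_apply (S.contDiff_X.clm_apply h₁.contDiff_fderiv)

omit [LieAlgebra.IsKilling 𝕜 g] in
/-- The derivative of the bracket of two functions on the slice. -/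
theorem fderiv_bracket {Q₁ Q₂ : lowestWeight 𝕜 tm → 𝕜}
    (h₁ : IsSmooth Q₁) (h₂ : IsSmooth Q₂) (w u : lowestWeight 𝕜 tm) :
    fderiv 𝕜 (fun w => fderiv 𝕜 Q₂ w (S.X w (fderiv 𝕜 Q₁ w))) w u =
      killingForm 𝕜 g (u : g) ⁅S.A w (fderiv 𝕜 Q₁ w), S.A w (fderiv 𝕜 Q₂ w)⁆
      - fderiv 𝕜 (fderiv 𝕜 Q₁) w u (S.X w (fderiv 𝕜 Q₂ w))
      + fderiv 𝕜 (fderiv 𝕜 Q₂) w u (S.X w (fderiv 𝕜 Q₁ w)) := by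
  -- The corrected gradient pairs with g_lw as dQ identically in w, so its derivative pairs with
  -- g_lw as the Hessian of Q.
  have key : ∀ {Q : lowestWeight 𝕜 tm → 𝕜}, IsSmooth Q → ∃ D : lowestWeight 𝕜 tm →L[𝕜] g,
      HasFDerivAt (fun w => S.A w (fderiv 𝕜 Q w)) D w ∧
      ∀ u v : lowestWeight 𝕜 tm, killingForm 𝕜 g (D u) v = fderiv 𝕜 (fderiv 𝕜 Q) w u v := by
    intro Q hQ
    have hs : ContDiff 𝕜 (⊤ : ℕ∞) (fun w => S.A w (fderiv 𝕜 Q w)) :=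
      S.contDiff_A.clm_apply hQ.contDiff_fderiv
    have hd := (hs.differentiable (by simp) w).hasFDerivAt
    refine ⟨_, hd, fun u v => ?_⟩
    have h1 : HasFDerivAt (fun w => killingL 𝕜 g (S.A w (fderiv 𝕜 Q w)) (v : g))
        (((killingL 𝕜 g).flip (v : g)).comp _) w :=
      ((killingL 𝕜 g).flip (v : g)).hasFDerivAt.comp w hd
    have h2 : (fun w => killingL 𝕜 g (S.A w (fderiv 𝕜 Q w)) (v : g)) = fun w => fderiv 𝕜 Q w v :=
      funext fun w => S.killingForm_A w _ v
    rw [h2] at h1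
    have h3 : HasFDerivAt (fun w => fderiv 𝕜 Q w v)
        ((ContinuousLinearMap.apply 𝕜 𝕜 v).comp (fderiv 𝕜 (fderiv 𝕜 Q) w)) w :=
      (ContinuousLinearMap.apply 𝕜 𝕜 v).hasFDerivAt.comp w
        ((hQ.contDiff_fderiv.differentiable (by simp) w).hasFDerivAt)
    exact DFunLike.congr_fun (h1.unique h3) u
  obtain ⟨D₁, hD₁, hk₁⟩ := key h₁
  obtain ⟨D₂, hD₂, hk₂⟩ := key h₂
  have hfun : (fun w => fderiv 𝕜 Q₂ w (S.X w (fderiv 𝕜 Q₁ w))) = fun w : lowestWeight 𝕜 tm =>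
      killingL 𝕜 g (tp + (w : g)) (lieL 𝕜 g (S.A w (fderiv 𝕜 Q₁ w)) (S.A w (fderiv 𝕜 Q₂ w))) :=
    funext fun w => S.apply_X w _ _
  have hx : HasFDerivAt (fun w : lowestWeight 𝕜 tm => tp + (w : g))
      (lowestWeight 𝕜 tm).subtypeL w :=
    ((lowestWeight 𝕜 tm).subtypeL.hasFDerivAt).const_add tp
  have hb : HasFDerivAt (fun w : lowestWeight 𝕜 tm =>
      lieL 𝕜 g (S.A w (fderiv 𝕜 Q₁ w)) (S.A w (fderiv 𝕜 Q₂ w))) _ w :=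
    (lieL 𝕜 g).hasFDerivAt_of_bilinear hD₁ hD₂
  have hall := (killingL 𝕜 g).hasFDerivAt_of_bilinear hx hb
  rw [hfun, hall.fderiv]
  -- Since [x, A dQ₁] lies in g_lw, only the pairing of `D₂ u` with g_lw matters; the derivative of
  -- `A` itself is never needed.
  have e1 : killingForm 𝕜 g (tp + (w : g)) ⁅S.A w (fderiv 𝕜 Q₁ w), D₂ u⁆ =
      fderiv 𝕜 (fderiv 𝕜 Q₂) w u (S.X w (fderiv 𝕜 Q₁ w)) := by
    rw [← hk₂, killingForm_comm (D₂ u), S.coe_X, killingForm_lie]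
  have e2 : killingForm 𝕜 g (tp + (w : g)) ⁅D₁ u, S.A w (fderiv 𝕜 Q₂ w)⁆ =
      - fderiv 𝕜 (fderiv 𝕜 Q₁) w u (S.X w (fderiv 𝕜 Q₂ w)) := by
    rw [← hk₁, killingForm_comm (D₁ u), S.coe_X, killingForm_lie, killingForm_lie_skew]
  change killingForm 𝕜 g (tp + (w : g)) (⁅S.A w (fderiv 𝕜 Q₁ w), D₂ u⁆ +
    ⁅D₁ u, S.A w (fderiv 𝕜 Q₂ w)⁆) +
    killingForm 𝕜 g (u : g) ⁅S.A w (fderiv 𝕜 Q₁ w), S.A w (fderiv 𝕜 Q₂ w)⁆ = _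
  rw [map_add, e1, e2]
  ring

include S in
theorem isPoissonBracket_wBracket (ht : IsSl2Embedding t0 tp tm) :
    IsPoissonBracket (wBracket (𝕜 := 𝕜) tp tm) where
  smooth f h hf hh := by
    rw [S.wBracket_eq_fun ht hf hh]
    exact S.isSmooth_bracket hf hh
  add_left f₁ f₂ h h₁ h₂ hh := by
    rw [S.wBracket_eq_fun ht (Q₁ := f₁ + f₂) (ContDiff.add h₁ h₂) hh, S.wBracket_eq_fun ht h₁ hh,
      S.wBracket_eq_fun ht h₂ hh]
    funext w
    rw [fderiv_add (h₁.differentiable w) (h₂.differentiable w)]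
    simp only [map_add, Pi.add_apply]
  smul_left c f h hf hh := by
    rw [S.wBracket_eq_fun ht (Q₁ := c • f) (ContDiff.const_smul c hf) hh,
      S.wBracket_eq_fun ht hf hh]
    funext w
    rw [fderiv_const_smul (hf.differentiable w)]
    simp only [map_smul, Pi.smul_apply]
  skew f h hf hh := by
    rw [S.wBracket_eq_fun ht hf hh, S.wBracket_eq_fun ht hh hf]
    funext w
    exact S.apply_X_skew w _ _
  leibniz f h₁ h₂ hf hh₁ hh₂ := by
    rw [S.wBracket_eq_fun ht (Q₂ := h₁ * h₂) hf (ContDiff.mul hh₁ hh₂), S.wBracket_eq_fun ht hf hh₁,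
      S.wBracket_eq_fun ht hf hh₂]
    funext w
    rw [fderiv_mul (hh₁.differentiable w) (hh₂.differentiable w)]
    simp only [_root_.add_apply, _root_.smul_apply, Pi.add_apply,
      Pi.mul_apply, smul_eq_mul]
    ring
  jacobi f₁ f₂ f₃ h₁ h₂ h₃ := by
    rw [S.wBracket_eq_fun ht h₂ h₃, S.wBracket_eq_fun ht h₃ h₁, S.wBracket_eq_fun ht h₁ h₂,
      S.wBracket_eq_fun ht h₁ (S.isSmooth_bracket h₂ h₃),
      S.wBracket_eq_fun ht h₂ (S.isSmooth_bracket h₃ h₁),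
      S.wBracket_eq_fun ht h₃ (S.isSmooth_bracket h₁ h₂)]
    funext w
    simp only [Pi.add_apply, Pi.zero_apply]
    rw [S.fderiv_bracket h₂ h₃, S.fderiv_bracket h₃ h₁, S.fderiv_bracket h₁ h₂]
    -- By symmetry the six Hessian terms cancel in pairs; what remains is x paired with the Jacobi
    -- identity of g.
    have hsymm : ∀ {Q : lowestWeight 𝕜 tm → 𝕜}, IsSmooth Q → ∀ u v,
        fderiv 𝕜 (fderiv 𝕜 Q) w u v = fderiv 𝕜 (fderiv 𝕜 Q) w v u := by
      intro Q hQ u v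
      refine (ContDiff.contDiffAt hQ).isSymmSndFDerivAt ?_ u v
      rw [minSmoothness_of_isRCLikeNormedField]
      exact WithTop.coe_le_coe.mpr (le_top (a := (2 : ℕ∞)))
    rw [hsymm h₁ (S.X w (fderiv 𝕜 f₂ w)), hsymm h₂ (S.X w (fderiv 𝕜 f₃ w)),
      hsymm h₃ (S.X w (fderiv 𝕜 f₁ w))]
    set a₁ := S.A w (fderiv 𝕜 f₁ w)
    set a₂ := S.A w (fderiv 𝕜 f₂ w)
    set a₃ := S.A w (fderiv 𝕜 f₃ w)
    simp only [S.coe_X, killingForm_lie]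
    have hj : killingForm 𝕜 g (tp + (w : g)) ⁅a₁, ⁅a₂, a₃⁆⁆ +
        killingForm 𝕜 g (tp + (w : g)) ⁅a₂, ⁅a₃, a₁⁆⁆ +
        killingForm 𝕜 g (tp + (w : g)) ⁅a₃, ⁅a₁, a₂⁆⁆ = 0 := by
      rw [← map_add, ← map_add, lie_jacobi, map_zero]
    linear_combination hj

end SliceLift

end Bivector

/-! ### Hamiltonian vectors as orbit directions tangent to the slice -/

section HamiltonianSpan

variable {𝕜 g : Type*} [RCLike 𝕜] [NormedLieRing g] [NormedLieAlgebra 𝕜 g]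
  [FiniteDimensional 𝕜 g] [LieAlgebra.IsKilling 𝕜 g] {t0 tp tm : g}

theorem isSmooth_clm {V : Type*} [NormedAddCommGroup V] [NormedSpace 𝕜 V] (α : V →L[𝕜] 𝕜) :
    IsSmooth (α : V → 𝕜) :=
  α.contDiff

omit [LieAlgebra.IsKilling 𝕜 g] in
/-- The orbit of a point of the slice meets the slice transversally. -/
theorem IsSl2Embedding.range_ad_sup_lowestWeight (ht : IsSl2Embedding t0 tp tm)
    (w : lowestWeight 𝕜 tm) :
    LinearMap.range (LieAlgebra.ad 𝕜 g (tp + (w : g))) ⊔ lowestWeight 𝕜 tm = ⊤ := by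
  set x := tp + (w : g)
  -- Already [x, im(ad t₋)] is a complement of g_lw: it meets g_lw trivially and has the dimension
  -- of im(ad t₋).
  let M := LinearMap.range (LieAlgebra.ad 𝕜 g tm)
  let f : M →ₗ[𝕜] g := (LieAlgebra.ad 𝕜 g x).domRestrict M
  have hf : ∀ a : M, f a = ⁅x, (a : g)⁆ := fun a => rfl
  have hinj : Function.Injective f := by
    rw [← LinearMap.ker_eq_bot, LinearMap.ker_eq_bot']
    intro a ha
    rw [hf] at ha
    exact Subtype.ext (ht.eq_zero_of_lie_mem w.2 a.2 (by rw [ha]; exact zero_mem _))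
  have hdisj : LinearMap.range f ⊓ lowestWeight 𝕜 tm = ⊥ := by
    rw [eq_bot_iff]
    rintro _ ⟨⟨a, rfl⟩, h2⟩
    have := ht.eq_zero_of_lie_mem w.2 a.2 h2
    rw [Submodule.mem_bot, hf, this, lie_zero]
  have hle : LinearMap.range f ≤ LinearMap.range (LieAlgebra.ad 𝕜 g x) := by
    rintro _ ⟨a, rfl⟩
    exact ⟨a, rfl⟩
  refine top_le_iff.mp (le_trans (top_le_iff.mpr ?_) (sup_le_sup_right hle _))
  apply Submodule.eq_top_of_finrank_eq
  have h1 := Submodule.finrank_sup_add_finrank_inf_eq (LinearMap.range f) (lowestWeight 𝕜 tm)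
  rw [hdisj, finrank_bot, LinearMap.finrank_range_of_inj hinj] at h1
  have h2 : Module.finrank 𝕜 M + Module.finrank 𝕜 (lowestWeight 𝕜 tm) = _ :=
    LinearMap.finrank_range_add_finrank_ker (LieAlgebra.ad 𝕜 g tm)
  omega

namespace SliceLift

variable (S : SliceLift 𝕜 tp tm) (ht : IsSl2Embedding t0 tp tm)
include ht

theorem isHamiltonianVector_iff {f : lowestWeight 𝕜 tm → 𝕜} (hf : IsSmooth f)
    {w v : lowestWeight 𝕜 tm} :
    IsHamiltonianVector (wBracket tp tm) f w v ↔ v = S.X w (fderiv 𝕜 f w) := by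
  constructor
  · intro h
    rw [SeparatingDual.eq_iff_forall_dual_eq (R := 𝕜)]
    intro α
    have := h α (isSmooth_clm α)
    rwa [S.wBracket_eq ht (hf.differentiable w) α.differentiableAt, α.fderiv] at this
  · rintro rfl h hh
    rw [S.wBracket_eq ht (hf.differentiable w) (hh.differentiable w)]

/-- Linear functions already realize every covector at w. -/
theorem hamiltonianSpan_eq (w : lowestWeight 𝕜 tm) :
    hamiltonianSpan (wBracket tp tm) w = LinearMap.range
      ((S.X w : (lowestWeight 𝕜 tm →L[𝕜] 𝕜) →L[𝕜] lowestWeight 𝕜 tm) :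
      (lowestWeight 𝕜 tm →L[𝕜] 𝕜) →ₗ[𝕜] lowestWeight 𝕜 tm) := by
  apply le_antisymm
  · apply Submodule.span_le.mpr
    rintro v ⟨f, hf, hv⟩
    exact ⟨fderiv 𝕜 f w, ((S.isHamiltonianVector_iff ht hf).mp hv).symm⟩
  · rintro _ ⟨α, rfl⟩
    apply Submodule.subset_span
    refine ⟨α, isSmooth_clm α, (S.isHamiltonianVector_iff ht (isSmooth_clm α)).mpr ?_⟩
    rw [α.fderiv]
    rfl

include S in
-- Identifies the span with im(ad x) ∩ g_lw. If [x, a] ∈ g_lw, then a is the lift of its own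
-- restriction α to g_lw, because transversality applies to a - A α.
theorem mem_hamiltonianSpan_iff {w v : lowestWeight 𝕜 tm} :
    v ∈ hamiltonianSpan (wBracket tp tm) w ↔ ∃ a : g, ⁅tp + (w : g), a⁆ = (v : g) := by
  rw [S.hamiltonianSpan_eq ht]
  constructor
  · rintro ⟨α, rfl⟩
    exact ⟨S.A w α, (S.coe_X w α).symm⟩
  · rintro ⟨a, ha⟩
    let α : lowestWeight 𝕜 tm →L[𝕜] 𝕜 := (killingL 𝕜 g a).comp (lowestWeight 𝕜 tm).subtypeL
    refine ⟨α, Subtype.ext ?_⟩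
    have h0 : a - S.A w α = 0 := by
      refine ht.eq_zero_of_orthogonal w.2 (fun u hu => ?_) ?_
      · rw [map_sub, LinearMap.sub_apply, S.killingForm_A w α ⟨u, hu⟩]
        exact sub_self _
      · rw [lie_sub, ha]
        exact sub_mem v.2 (S.lie_A_mem w α)
    rw [← ha, sub_eq_zero.mp h0]
    exact S.coe_X w α

include S in
-- A skew map X from covectors to vectors induces on its range the form ω(X α, X β) = β(X α). It is
-- written with a section `s` of X, and skewness makes it independent of that choice.
theorem isNondegenerateOn (w : lowestWeight 𝕜 tm) :
    IsNondegenerateOn (wBracket (𝕜 := 𝕜) tp tm) w (hamiltonianSpan (wBracket tp tm) w) := by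
  have hspan := S.hamiltonianSpan_eq ht w
  constructor
  · intro f hf
    refine ⟨S.X w (fderiv 𝕜 f w), ?_, (S.isHamiltonianVector_iff ht hf).mpr rfl⟩
    rw [hspan]
    exact ⟨_, rfl⟩
  rw [hspan]
  set X : (lowestWeight 𝕜 tm →L[𝕜] 𝕜) →ₗ[𝕜] lowestWeight 𝕜 tm :=
    (S.X w).toLinearMap with hX
  have hskew : ∀ α β : lowestWeight 𝕜 tm →L[𝕜] 𝕜, β (X α) = - α (X β) := S.apply_X_skew w
  obtain ⟨s, hs⟩ := X.rangeRestrict.exists_rightInverse_of_surjective X.range_rangeRestrict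
  have hs' : ∀ u : LinearMap.range X, X (s u) = u := fun u =>
    congrArg Subtype.val (DFunLike.congr_fun hs u)
  let ev : LinearMap.range X →ₗ[𝕜] (lowestWeight 𝕜 tm →L[𝕜] 𝕜) →ₗ[𝕜] 𝕜 :=
    LinearMap.mk₂ 𝕜 (fun u α => α (u : lowestWeight 𝕜 tm))
      (by intros; simp) (by intros; simp) (by intros; simp) (by intros; simp)
  let ω : LinearMap.BilinForm 𝕜 (LinearMap.range X) := ev.compl₂ s
  have hω : ∀ u v, ω u v = s v (u : lowestWeight 𝕜 tm) := fun u v => rfl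
  have halt : ω.IsAlt := by
    intro u
    rw [hω]
    conv_lhs => rw [← hs' u]
    exact S.apply_X_self w _
  have hsepR : ω.SeparatingRight := by
    intro v hv
    apply Subtype.ext
    rw [ZeroMemClass.coe_zero, SeparatingDual.eq_iff_forall_dual_eq (R := 𝕜)]
    intro α
    have := hv ⟨X α, α, rfl⟩
    rw [hω, hskew, hs'] at this
    rw [map_zero]
    exact neg_eq_zero.mp this
  have hsepL : ω.SeparatingLeft := by
    intro u hu
    apply hsepR
    intro v
    rw [← LinearMap.IsAlt.neg halt u v, hu v, neg_zero]
  refine ⟨ω, halt, ⟨hsepL, hsepR⟩, ?_⟩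
  intro f h u v hf hh hu hv
  rw [S.isHamiltonianVector_iff ht hf] at hu
  rw [S.isHamiltonianVector_iff ht hh] at hv
  have hu' : (u : lowestWeight 𝕜 tm) = X (fderiv 𝕜 f w) := hu
  have hv' : (v : lowestWeight 𝕜 tm) = X (fderiv 𝕜 h w) := hv
  rw [hω, hu', hskew, hs', hv', ← hskew, S.wBracket_eq ht (hf.differentiable w)
    (hh.differentiable w)]
  rfl

include S in
-- The dimension formula for a transversal intersection, with im(ad x) of dimension dim g minus that
-- of the centralizer.
theorem finrank_hamiltonianSpan (w : lowestWeight 𝕜 tm) :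
    Module.finrank 𝕜 (hamiltonianSpan (wBracket (𝕜 := 𝕜) tp tm) w) +
      Module.finrank 𝕜 (LinearMap.ker (LieAlgebra.ad 𝕜 g (tp + (w : g)))) =
      Module.finrank 𝕜 (lowestWeight 𝕜 tm) := by
  set x := tp + (w : g) with hx
  have h0 : hamiltonianSpan (wBracket (𝕜 := 𝕜) tp tm) w =
      (LinearMap.range (LieAlgebra.ad 𝕜 g x)).submoduleOf (lowestWeight 𝕜 tm) := by
    ext v
    rw [S.mem_hamiltonianSpan_iff ht]
    rfl
  have h1 := Submodule.finrank_sup_add_finrank_inf_eq (LinearMap.range (LieAlgebra.ad 𝕜 g x))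
    (lowestWeight 𝕜 tm)
  rw [ht.range_ad_sup_lowestWeight w, finrank_top] at h1
  have h2 := LinearMap.finrank_range_add_finrank_ker (LieAlgebra.ad 𝕜 g x)
  have h3 : Module.finrank 𝕜 (hamiltonianSpan (wBracket (𝕜 := 𝕜) tp tm) w) =
      Module.finrank 𝕜 ↥(LinearMap.range (LieAlgebra.ad 𝕜 g x) ⊓ lowestWeight 𝕜 tm) := by
    rw [h0]
    have h4 := Submodule.map_comap_subtype (lowestWeight 𝕜 tm)
      (LinearMap.range (LieAlgebra.ad 𝕜 g x))
    rw [inf_comm, ← h4]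
    exact (Submodule.finrank_map_subtype_eq _ _).symm
  omega

end SliceLift

end HamiltonianSpan

open Filter Topology

/-! ### Similar operators that are close to each other -/

section Similar

theorem exists_bound_of_disjoint_ker {𝕜 V W : Type*} [RCLike 𝕜] [NormedAddCommGroup V]
    [NormedSpace 𝕜 V] [FiniteDimensional 𝕜 V] [NormedAddCommGroup W] [NormedSpace 𝕜 W]
    (T : V →ₗ[𝕜] W) {C : Submodule 𝕜 V} (hC : LinearMap.ker T ⊓ C = ⊥) :
    ∃ K : ℝ, 0 < K ∧ ∀ c ∈ C, ‖c‖ ≤ K * ‖T c‖ := by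
  have hinj : LinearMap.ker (T.domRestrict C) = ⊥ := by
    rw [LinearMap.ker_eq_bot']
    intro c hc
    have : (c : V) ∈ LinearMap.ker T ⊓ C := ⟨hc, c.2⟩
    rw [hC] at this
    exact Subtype.ext this
  obtain ⟨K, hK, hanti⟩ := LinearMap.exists_antilipschitzWith (T.domRestrict C) hinj
  exact ⟨K, hK, fun c hc => by simpa using hanti.le_mul_dist ⟨c, hc⟩ 0⟩

open NormedSpace in
-- The strict derivative at 0 is (x, y) ↦ f x + k y, which is onto.
theorem map_nhds_exp_mul {𝕜 E₁ E₂ A : Type*} [RCLike 𝕜] [NormedAddCommGroup E₁]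
    [NormedSpace 𝕜 E₁] [CompleteSpace E₁] [NormedAddCommGroup E₂] [NormedSpace 𝕜 E₂]
    [CompleteSpace E₂] [NormedRing A] [NormedAlgebra 𝕜 A] [CompleteSpace A]
    (f : E₁ →L[𝕜] A) (k : E₂ →L[𝕜] A) (h : ∀ b : A, ∃ x y, f x + k y = b) :
    map (fun p : E₁ × E₂ => exp (f p.1) * (1 + k p.2)) (𝓝 0) = 𝓝 1 := by
  let f' : E₁ × E₂ →L[𝕜] A := f.comp (ContinuousLinearMap.fst 𝕜 E₁ E₂)
  let k' : E₁ × E₂ →L[𝕜] A := k.comp (ContinuousLinearMap.snd 𝕜 E₁ E₂)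
  have h0 : HasStrictFDerivAt (exp : A → A) (1 : A →L[𝕜] A) (f' 0) := by
    rw [map_zero]
    exact hasStrictFDerivAt_exp_zero
  have h1 : HasStrictFDerivAt (fun p => exp (f' p)) ((1 : A →L[𝕜] A).comp f') 0 :=
    h0.comp 0 f'.hasStrictFDerivAt
  have h2 : HasStrictFDerivAt (fun p => 1 + k' p) k' 0 := k'.hasStrictFDerivAt.const_add 1
  have h3 : HasStrictFDerivAt (fun p : E₁ × E₂ => exp (f p.1) * (1 + k p.2)) (f' + k') 0 := by
    refine (h1.mul' h2).congr_fderiv ?_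
    refine ContinuousLinearMap.ext fun p => ?_
    simp [f', k', add_comm]
  rw [h3.map_nhds_eq_of_surj]
  · simp
  · rw [LinearMap.range_eq_top]
    intro b
    obtain ⟨x, y, hxy⟩ := h b
    exact ⟨(x, y), hxy⟩

variable {𝕜 E : Type*} [RCLike 𝕜] [NormedAddCommGroup E] [NormedSpace 𝕜 E]
  [FiniteDimensional 𝕜 E]

/-- An operator near `X` that is similar to `X` is conjugate to it by an operator near `1`. -/
theorem eventually_exists_intertwining_near_one (X : E →L[𝕜] E) {N : Set (E →L[𝕜] E)}
    (hN : N ∈ 𝓝 (1 : E →L[𝕜] E)) :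
    ∀ᶠ Y in 𝓝 X, (∃ u : (E →L[𝕜] E)ˣ, (u : E →L[𝕜] E) * X = Y * u) → ∃ k ∈ N, k * X = Y * k := by
  let T : (E →L[𝕜] E) → (E →L[𝕜] E) →ₗ[𝕜] (E →L[𝕜] E) := fun Y =>
    LinearMap.mulRight 𝕜 X - LinearMap.mulLeft 𝕜 Y
  have hT : ∀ Y k, T Y k = k * X - Y * k := fun Y k => rfl
  -- `T Y` has the intertwiners of X and Y as kernel. Being bounded below on `C` persists from X to
  -- nearby Y (radius 1/(2K)), so `C` still meets the kernel trivially.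
  obtain ⟨C, hC⟩ := Submodule.exists_isCompl (LinearMap.ker (T X))
  obtain ⟨K, hKpos, hlow⟩ := exists_bound_of_disjoint_ker (T X) hC.inf_eq_bot
  obtain ⟨ε, hε, hεN⟩ := Metric.mem_nhds_iff.mp hN
  filter_upwards [Metric.ball_mem_nhds X (show 0 < min (1 / (2 * K)) (ε / (2 * K)) by positivity)]
    with Y hY ⟨u, hu⟩
  rw [mem_ball_iff_norm, lt_min_iff] at hY
  have hlowY : ∀ c ∈ C, ‖c‖ ≤ 2 * K * ‖T Y c‖ := by
    intro c hc
    have h1 := hlow c hc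
    have h2 : T X c = T Y c + (Y - X) * c := by rw [hT, hT, sub_mul]; abel
    have h3 : ‖T X c‖ ≤ ‖T Y c‖ + ‖Y - X‖ * ‖c‖ := by
      rw [h2]
      exact (norm_add_le _ _).trans (by gcongr; exact norm_mul_le _ _)
    have h4 : K * ‖Y - X‖ ≤ 1 / 2 := by
      have := mul_le_mul_of_nonneg_left hY.1.le hKpos.le
      refine this.trans (le_of_eq ?_)
      field_simp
    have h5 : K * (‖Y - X‖ * ‖c‖) ≤ 1 / 2 * ‖c‖ := by
      rw [← mul_assoc]; gcongr
    have h6 := mul_le_mul_of_nonneg_left h3 hKpos.le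
    rw [mul_add] at h6
    linarith
  have hdisj : LinearMap.ker (T Y) ⊓ C = ⊥ := by
    rw [eq_bot_iff]
    rintro c ⟨h1, h2⟩
    have := hlowY c h2
    rw [LinearMap.mem_ker.mp h1, norm_zero, mul_zero] at this
    exact norm_le_zero_iff.mp this
  -- Similarity is used here only: left multiplication by `u` carries the commutant of X onto the
  -- intertwiners.
  have hrank : Module.finrank 𝕜 (LinearMap.ker (T Y)) = Module.finrank 𝕜 (LinearMap.ker (T X)) := by
    let U : (E →L[𝕜] E) ≃ₗ[𝕜] (E →L[𝕜] E) := LinearEquiv.ofLinearMap (LinearMap.mulLeft 𝕜 ↑u)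
      (LinearMap.mulLeft 𝕜 ↑u⁻¹) (by ext1 k; simp) (by ext1 k; simp)
    have hU : ∀ k, U k = u * k := fun k => rfl
    have hmap : LinearMap.ker (T X) = (LinearMap.ker (T Y)).comap (U : _ →ₗ[𝕜] _) := by
      ext k
      simp only [LinearMap.mem_ker, Submodule.mem_comap, LinearEquiv.coe_coe, hT, hU]
      rw [← mul_assoc, ← hu, mul_assoc, mul_assoc, ← mul_sub]
      exact (Units.mul_right_eq_zero u).symm
    have h := LinearEquiv.finrank_map_eq U ((LinearMap.ker (T Y)).comap (U : _ →ₗ[𝕜] _))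
    rw [Submodule.map_comap_eq_of_surjective U.surjective] at h
    rw [hmap, h]
  have htop : LinearMap.ker (T Y) ⊔ C = ⊤ := by
    apply Submodule.eq_top_of_finrank_eq
    have h1 := Submodule.finrank_sup_add_finrank_inf_eq (LinearMap.ker (T Y)) C
    rw [hdisj, finrank_bot] at h1
    have h2 := Submodule.finrank_add_eq_of_isCompl hC
    omega
  -- Split 1 = k + c. Since T_Y c = T_Y 1 = X - Y is small, so is c; the radius ε/(2K) makes it
  -- smaller than ε.
  obtain ⟨k, hk, c, hc, hkc⟩ := Submodule.mem_sup.mp (htop ▸ Submodule.mem_top :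
    (1 : E →L[𝕜] E) ∈ LinearMap.ker (T Y) ⊔ C)
  refine ⟨k, hεN ?_, sub_eq_zero.mp hk⟩
  rw [mem_ball_iff_norm, norm_sub_rev]
  have h1 : (1 : E →L[𝕜] E) - k = c := by rw [← hkc]; abel
  have h2 : T Y c = X - Y := by
    have : T Y 1 = X - Y := by rw [hT, one_mul, mul_one]
    rw [← this, ← hkc, map_add, LinearMap.mem_ker.mp hk, zero_add]
  rw [h1]
  refine (hlowY c hc).trans_lt ?_
  rw [h2, norm_sub_rev]
  calc 2 * K * ‖Y - X‖ < 2 * K * (ε / (2 * K)) := by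
        exact mul_lt_mul_of_pos_left hY.2 (by positivity)
    _ = ε := by field_simp

open NormedSpace in
theorem eventually_eq_exp_mul {𝕜 E₁ A : Type*} [RCLike 𝕜] [NormedAddCommGroup E₁]
    [NormedSpace 𝕜 E₁] [CompleteSpace E₁] [NormedRing A] [NormedAlgebra 𝕜 A]
    [FiniteDimensional 𝕜 A] (f : E₁ →L[𝕜] A) (M : Submodule 𝕜 A) (h : ∀ b : A, ∃ x, b - f x ∈ M)
    {N : Set E₁} (hN : N ∈ 𝓝 0) {δ : ℝ} (hδ : 0 < δ) :
    ∀ᶠ b in 𝓝 (1 : A), ∃ x ∈ N, ∃ m ∈ M, ‖m‖ < δ ∧ b = exp (f x) * (1 + m) := by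
  have : CompleteSpace A := FiniteDimensional.complete 𝕜 A
  have : CompleteSpace M := FiniteDimensional.complete 𝕜 M
  rw [← map_nhds_exp_mul f M.subtypeL fun b => ?_]
  · have hB : Metric.ball (0 : M) δ ∈ 𝓝 0 := Metric.ball_mem_nhds 0 hδ
    rw [eventually_map]
    filter_upwards [prod_mem_nhds hN hB] with p hp
    exact ⟨p.1, hp.1, p.2, p.2.2, by simpa using hp.2, rfl⟩
  · obtain ⟨x, hx⟩ := h b
    exact ⟨x, ⟨_, hx⟩, add_sub_cancel _ _⟩

end Similar

/-! ### The adjoint group and local rigidity of orbits -/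

section Orbit

open NormedSpace

variable {𝕜 g : Type*} [RCLike 𝕜] [NormedLieRing g] [NormedLieAlgebra 𝕜 g]
  [FiniteDimensional 𝕜 g]

variable (𝕜) in
/-- The automorphism `exp (ad a)`. -/
def expAd (a : g) : g →L[𝕜] g := exp (lieL 𝕜 g a)

theorem expAd_neg_mul (a : g) : expAd 𝕜 (-a) * expAd 𝕜 a = 1 := by
  have : CompleteSpace g := FiniteDimensional.complete 𝕜 g
  let := NormedAlgebra.restrictScalars ℚ 𝕜 (g →L[𝕜] g)
  have h := exp_add_of_commute (Commute.refl (lieL 𝕜 g a)).neg_left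
  rw [neg_add_cancel, exp_zero] at h
  rw [expAd, expAd, map_neg]
  exact h.symm

theorem expAd_mul_neg (a : g) : expAd 𝕜 a * expAd 𝕜 (-a) = 1 := by
  simpa using expAd_neg_mul (𝕜 := 𝕜) (-a)

theorem expAd_apply_neg (a v : g) : expAd 𝕜 a (expAd 𝕜 (-a) v) = v :=
  DFunLike.congr_fun (expAd_mul_neg a) v

/-- `exp (ad a)` is an automorphism of the Lie algebra. -/
theorem expAd_lie (a y z : g) : expAd 𝕜 a ⁅y, z⁆ = ⁅expAd 𝕜 a y, expAd 𝕜 a z⁆ := by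
  have : CompleteSpace g := FiniteDimensional.complete 𝕜 g
  let A := lieL 𝕜 g a
  have hd : ∀ (v : g) (t : 𝕜), HasDerivAt (fun t : 𝕜 => exp (t • A) v) (A (exp (t • A) v)) t := by
    intro v t
    exact (ContinuousLinearMap.apply 𝕜 g v).hasFDerivAt.comp_hasDerivAt t
      (hasDerivAt_exp_smul_const' A t)
  -- Constant in t, because ad a is a derivation.
  let f : 𝕜 → g := fun t => exp (t • (-A)) ⁅exp (t • A) y, exp (t • A) z⁆
  have hcomm : ∀ t : 𝕜, Commute (exp (t • (-A))) A := fun t =>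
    (((Commute.refl A).neg_left).smul_left t).exp_left
  have hf : ∀ t, HasDerivAt f 0 t := by
    intro t
    have h1 := hasDerivAt_exp_smul_const (-A) t
    have h2 : HasDerivAt (fun t : 𝕜 => lieL 𝕜 g (exp (t • A) y) (exp (t • A) z)) _ t :=
      ((lieL 𝕜 g).hasFDerivAt.comp_hasDerivAt t (hd y t)).clm_apply (hd z t)
    have h3 := h1.clm_apply h2
    refine h3.congr_deriv ?_
    change (exp (t • (-A)) * (-A)) ⁅exp (t • A) y, exp (t • A) z⁆ +
      exp (t • (-A)) (⁅⁅a, exp (t • A) y⁆, exp (t • A) z⁆ + ⁅exp (t • A) y, ⁅a, exp (t • A) z⁆⁆) = 0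
    rw [← leibniz_lie, mul_neg]
    change -(exp (t • (-A)) (A ⁅exp (t • A) y, exp (t • A) z⁆)) +
      exp (t • (-A)) (A ⁅exp (t • A) y, exp (t • A) z⁆) = 0
    exact neg_add_cancel _
  have hconst := is_const_of_deriv_eq_zero (fun t => (hf t).differentiableAt)
    (fun t => (hf t).deriv) 1 0
  have h1 : f 1 = expAd 𝕜 (-a) ⁅expAd 𝕜 a y, expAd 𝕜 a z⁆ := by
    simp only [f, one_smul, expAd, A, map_neg]
  have h0 : f 0 = ⁅y, z⁆ := by
    simp only [f, zero_smul, exp_zero]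
    rfl
  rw [← h0, ← hconst, h1, expAd_apply_neg]

theorem lie_mem_adjointGroup {u : (g →L[𝕜] g)ˣ} (hu : u ∈ adjointGroup 𝕜 g) :
    ∀ y z : g, (u : g →L[𝕜] g) ⁅y, z⁆ = ⁅(u : g →L[𝕜] g) y, (u : g →L[𝕜] g) z⁆ := by
  induction hu using Subgroup.closure_induction with
  | mem u hu =>
    obtain ⟨a, ha⟩ := hu
    intro y z
    rw [ha]
    exact expAd_lie a y z
  | one => intro y z; rfl
  | mul u v _ _ hu hv =>
    intro y z
    simp only [Units.val_mul, mul_apply_eq_comp, hv, hu]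
  | inv u _ hu =>
    intro y z
    have hinv : ∀ v, (u : g →L[𝕜] g) ((↑u⁻¹ : g →L[𝕜] g) v) = v := fun v =>
      DFunLike.congr_fun u.mul_inv v
    have hinv' : ∀ v, (↑u⁻¹ : g →L[𝕜] g) ((u : g →L[𝕜] g) v) = v := fun v =>
      DFunLike.congr_fun u.inv_mul v
    have h := hu ((↑u⁻¹ : g →L[𝕜] g) y) ((↑u⁻¹ : g →L[𝕜] g) z)
    rw [hinv, hinv] at h
    rw [← h, hinv']

theorem mem_adjointOrbit_self (x : g) : x ∈ adjointOrbit 𝕜 x := ⟨1, one_mem _, rfl⟩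

theorem adjointOrbit_eq_of_mem {x y : g} (h : y ∈ adjointOrbit 𝕜 x) :
    adjointOrbit 𝕜 y = adjointOrbit 𝕜 x := by
  obtain ⟨u, hu, rfl⟩ := h
  ext z
  constructor
  · rintro ⟨v, hv, rfl⟩
    exact ⟨v * u, mul_mem hv hu, rfl⟩
  · rintro ⟨v, hv, rfl⟩
    refine ⟨v * u⁻¹, mul_mem hv (inv_mem hu), ?_⟩
    have hinv' : ∀ v, (↑u⁻¹ : g →L[𝕜] g) ((u : g →L[𝕜] g) v) = v := fun v =>
      DFunLike.congr_fun u.inv_mul v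
    rw [Units.val_mul, mul_apply_eq_comp, hinv']

theorem expAd_mem_adjointOrbit (a x : g) : expAd 𝕜 a x ∈ adjointOrbit 𝕜 x :=
  ⟨⟨expAd 𝕜 a, expAd 𝕜 (-a), expAd_mul_neg a, expAd_neg_mul a⟩,
    Subgroup.subset_closure ⟨a, rfl⟩, rfl⟩

/-- Similarity of the adjoint operators is necessary for lying in one orbit;
`eventually_exists_expAd_eq_of_conj` is a local converse. -/
theorem exists_conj_of_mem_adjointOrbit {x y : g} (h : y ∈ adjointOrbit 𝕜 x) :
    ∃ u : (g →L[𝕜] g)ˣ, (u : g →L[𝕜] g) * lieL 𝕜 g x = lieL 𝕜 g y * u := by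
  obtain ⟨u, hu, rfl⟩ := h
  exact ⟨u, ContinuousLinearMap.ext fun z => lie_mem_adjointGroup hu x z⟩

theorem finrank_ker_ad_eq_of_conj {x y : g} {u : (g →L[𝕜] g)ˣ}
    (h : (u : g →L[𝕜] g) * lieL 𝕜 g x = lieL 𝕜 g y * u) :
    Module.finrank 𝕜 (LinearMap.ker (LieAlgebra.ad 𝕜 g y)) =
      Module.finrank 𝕜 (LinearMap.ker (LieAlgebra.ad 𝕜 g x)) := by
  have hinv : ∀ v, (u : g →L[𝕜] g) ((↑u⁻¹ : g →L[𝕜] g) v) = v := fun v =>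
    DFunLike.congr_fun u.mul_inv v
  have hinv' : ∀ v, (↑u⁻¹ : g →L[𝕜] g) ((u : g →L[𝕜] g) v) = v := fun v =>
    DFunLike.congr_fun u.inv_mul v
  let U : g ≃ₗ[𝕜] g := LinearEquiv.ofLinearMap (u : g →L[𝕜] g).toLinearMap
    (↑u⁻¹ : g →L[𝕜] g).toLinearMap (LinearMap.ext hinv) (LinearMap.ext hinv')
  have hU : ∀ k, U k = (u : g →L[𝕜] g) k := fun k => rfl
  have hmap : LinearMap.ker (LieAlgebra.ad 𝕜 g x) =
      (LinearMap.ker (LieAlgebra.ad 𝕜 g y)).comap (U : g →ₗ[𝕜] g) := by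
    ext k
    have h1 : (u : g →L[𝕜] g) ⁅x, k⁆ = ⁅y, (u : g →L[𝕜] g) k⁆ := DFunLike.congr_fun h k
    simp only [LinearMap.mem_ker, Submodule.mem_comap, LinearEquiv.coe_coe, hU,
      LieAlgebra.ad_apply, ← h1]
    exact (map_eq_zero_iff (U : g →ₗ[𝕜] g) U.injective).symm
  have h2 := LinearEquiv.finrank_map_eq U
    ((LinearMap.ker (LieAlgebra.ad 𝕜 g y)).comap (U : g →ₗ[𝕜] g))
  rw [Submodule.map_comap_eq_of_surjective U.surjective] at h2
  rw [hmap, h2]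

theorem finrank_ker_ad_eq_of_mem_adjointOrbit {x y : g} (h : y ∈ adjointOrbit 𝕜 x) :
    Module.finrank 𝕜 (LinearMap.ker (LieAlgebra.ad 𝕜 g y)) =
      Module.finrank 𝕜 (LinearMap.ker (LieAlgebra.ad 𝕜 g x)) := by
  obtain ⟨u, hu⟩ := exists_conj_of_mem_adjointOrbit h
  exact finrank_ker_ad_eq_of_conj hu

theorem contDiff_expAd {n : WithTop ℕ∞} : ContDiff 𝕜 n (expAd 𝕜 : g → g →L[𝕜] g) := by
  have : CompleteSpace g := FiniteDimensional.complete 𝕜 g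
  have h1 : ContDiff 𝕜 n (exp : (g →L[𝕜] g) → (g →L[𝕜] g)) :=
    contDiff_iff_contDiffAt.mpr fun x => (exp_analytic (𝕂 := 𝕜) x).contDiffAt
  exact h1.comp (lieL 𝕜 g).contDiff

theorem expAd_zero : expAd 𝕜 (0 : g) = 1 := by
  rw [expAd, map_zero, exp_zero]

variable [LieAlgebra.IsKilling 𝕜 g]

variable (𝕜 g) in
/-- The orthogonal projection of `gl(g)` onto `ad g` for the trace form, as a map to `g`. -/
theorem exists_equivariant_projection : ∃ π : (g →L[𝕜] g) →L[𝕜] g,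
    (∀ a, π (lieL 𝕜 g a) = a) ∧
    ∀ b y, π (b * lieL 𝕜 g y - lieL 𝕜 g y * b) = ⁅π b, y⁆ := by
  have hnd := LieAlgebra.IsKilling.killingForm_nondegenerate 𝕜 g
  -- `π b` represents y ↦ tr(b ∘ ad y) by the Killing form. Equivariance is cyclicity of the trace.
  let tr : (g →L[𝕜] g) →ₗ[𝕜] Module.Dual 𝕜 g :=
    LinearMap.mk₂ 𝕜 (fun b y => LinearMap.trace 𝕜 g (b.toLinearMap * LieAlgebra.ad 𝕜 g y))
      (by intros; simp [add_mul]) (by intros; simp) (by intros; simp [mul_add]) (by intros; simp)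
  have htr : ∀ b y, tr b y = LinearMap.trace 𝕜 g (b.toLinearMap * LieAlgebra.ad 𝕜 g y) :=
    fun b y => rfl
  let π : (g →L[𝕜] g) →L[𝕜] g := LinearMap.toContinuousLinearMap
    (((killingForm 𝕜 g).toDual hnd).symm.toLinearMap ∘ₗ tr)
  have hπ : ∀ b y, killingForm 𝕜 g (π b) y = tr b y := fun b y =>
    LinearMap.BilinForm.apply_toDual_symm_apply (hB := hnd) (tr b) y
  refine ⟨π, fun a => eq_of_killingForm_eq (𝕜 := 𝕜) fun v => ?_, fun b y =>
    eq_of_killingForm_eq (𝕜 := 𝕜) fun z => ?_⟩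
  · rw [hπ]
    rfl
  · rw [hπ, killingForm_lie, hπ, htr, htr]
    have h1 : (LieAlgebra.ad 𝕜 g ⁅y, z⁆ : Module.End 𝕜 g) =
        LieAlgebra.ad 𝕜 g y * LieAlgebra.ad 𝕜 g z - LieAlgebra.ad 𝕜 g z * LieAlgebra.ad 𝕜 g y := by
      ext v
      simp
    have h2 : (b * lieL 𝕜 g y - lieL 𝕜 g y * b).toLinearMap =
        b.toLinearMap * LieAlgebra.ad 𝕜 g y - LieAlgebra.ad 𝕜 g y * b.toLinearMap := rfl
    rw [h1, h2, mul_sub, sub_mul, map_sub, map_sub, mul_assoc, mul_assoc,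
      LinearMap.trace_mul_comm 𝕜 (LieAlgebra.ad 𝕜 g y), mul_assoc]

/-- Elements near `y₀` whose adjoint operator is similar to that of `y₀` are conjugate to `y₀`
by the exponential of a small element of a given complement of the centralizer of `y₀`. -/
theorem eventually_exists_expAd_eq_of_conj (y₀ : g) {D : Submodule 𝕜 g}
    (hD : IsCompl D (LinearMap.ker (LieAlgebra.ad 𝕜 g y₀))) {N : Set D} (hN : N ∈ 𝓝 (0 : D)) :
    ∀ᶠ y in 𝓝 y₀, (∃ u : (g →L[𝕜] g)ˣ, (u : g →L[𝕜] g) * lieL 𝕜 g y₀ = lieL 𝕜 g y * u) →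
      ∃ a ∈ N, y = expAd 𝕜 (a : g) y₀ := by
  have : CompleteSpace g := FiniteDimensional.complete 𝕜 g
  obtain ⟨π, hπ1, hπ2⟩ := exists_equivariant_projection 𝕜 g
  let M : Submodule 𝕜 (g →L[𝕜] g) :=
    (LinearMap.ker (LieAlgebra.ad 𝕜 g y₀)).comap π.toLinearMap
  have : CompleteSpace D := FiniteDimensional.complete 𝕜 D
  set c : ℝ := ‖π‖ * ‖lieL 𝕜 g‖ with hc
  have hc0 : 0 ≤ c := by positivity
  -- Operators near 1 factor as exp(ad a)(1 + b) with a ∈ D small and π b centralizing y₀. The bound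
  -- 1/(c + 1) on ‖b‖ serves the contraction estimate at the end.
  have himg := eventually_eq_exp_mul ((lieL 𝕜 g).comp D.subtypeL) M (fun b => by
    obtain ⟨d, hd, k, hk, hdk⟩ := Submodule.mem_sup.mp (hD.sup_eq_top ▸ Submodule.mem_top :
      π b ∈ D ⊔ LinearMap.ker (LieAlgebra.ad 𝕜 g y₀))
    refine ⟨⟨d, hd⟩, ?_⟩
    change π (b - lieL 𝕜 g d) ∈ LinearMap.ker (LieAlgebra.ad 𝕜 g y₀)
    rw [map_sub, hπ1, ← hdk, add_sub_cancel_left]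
    exact hk) hN (show 0 < 1 / (c + 1) by positivity)
  have hev := eventually_exists_intertwining_near_one (lieL 𝕜 g y₀) himg
  filter_upwards [(lieL 𝕜 g).continuous.continuousAt.eventually hev] with y hy hu
  obtain ⟨_, ⟨a, ha, b, hbM, hb, rfl⟩, hk⟩ := hy hu
  change expAd 𝕜 (a : g) * (1 + b) * lieL 𝕜 g y₀ = lieL 𝕜 g y * (expAd 𝕜 (a : g) * (1 + b)) at hk
  refine ⟨a, ha, ?_⟩
  set y' := expAd 𝕜 (-(a : g)) y with hy'
  have hyy' : y = expAd 𝕜 (a : g) y' := by rw [hy', expAd_apply_neg]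
  have hconj : lieL 𝕜 g y * expAd 𝕜 (a : g) = expAd 𝕜 (a : g) * lieL 𝕜 g y' := by
    ext v
    have := expAd_lie (𝕜 := 𝕜) (a : g) y' v
    rw [← hyy'] at this
    exact this.symm
  have h1 : (1 + b) * lieL 𝕜 g y₀ = lieL 𝕜 g y' * (1 + b) := by
    have h2 : expAd 𝕜 (a : g) * ((1 + b) * lieL 𝕜 g y₀) =
        expAd 𝕜 (a : g) * (lieL 𝕜 g y' * (1 + b)) := by
      rw [← mul_assoc, ← mul_assoc, ← hconj, mul_assoc _ _ (1 + b)]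
      exact hk
    have h3 := congrArg (fun k => expAd 𝕜 (-(a : g)) * k) h2
    simpa only [← mul_assoc, expAd_neg_mul, one_mul] using h3
  set z := y' - y₀ with hz
  -- Applying `π` turns the left side into [π b, y₀] = 0, so z = -π(ad z ∘ b). Then ‖z‖ ≤ c‖b‖‖z‖
  -- with c‖b‖ < 1, which forces z = 0.
  have h2 : b * lieL 𝕜 g y₀ - lieL 𝕜 g y₀ * b = lieL 𝕜 g z + lieL 𝕜 g z * b := by
    rw [hz, map_sub]
    rw [add_mul, one_mul, mul_add, mul_one] at h1
    rw [eq_sub_of_add_eq' h1, sub_mul]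
    abel
  have h3 := congrArg π h2
  have hbM' : ⁅π b, y₀⁆ = 0 := by
    rw [← lie_skew]
    exact neg_eq_zero.mpr hbM
  rw [hπ2, hbM', map_add, hπ1] at h3
  have h4 : ‖z‖ ≤ c * ‖b‖ * ‖z‖ := by
    have h5 : z = -π (lieL 𝕜 g z * b) := eq_neg_of_add_eq_zero_left h3.symm
    calc ‖z‖ = ‖π (lieL 𝕜 g z * b)‖ := by conv_lhs => rw [h5, norm_neg]
      _ ≤ ‖π‖ * (‖lieL 𝕜 g‖ * ‖z‖ * ‖b‖) := by
        refine (π.le_opNorm _).trans ?_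
        gcongr
        refine (norm_mul_le _ _).trans ?_
        gcongr
        exact (lieL 𝕜 g).le_opNorm z
      _ = c * ‖b‖ * ‖z‖ := by rw [hc]; ring
  have hb' : c * ‖b‖ < 1 := by
    rw [lt_div_iff₀ (by positivity)] at hb
    nlinarith [norm_nonneg b]
  have hz0 : z = 0 := by
    by_contra hne
    have : 0 < ‖z‖ := norm_pos_iff.mpr hne
    nlinarith
  rw [hyy', ← sub_eq_zero.mp hz0]

end Orbit

open scoped ContDiff

/-! ### An analytic inverse function theorem -/

section InverseFunction

variable {𝕜 E F : Type*} [RCLike 𝕜] [NormedAddCommGroup E] [NormedSpace 𝕜 E] [CompleteSpace E]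
  [NormedAddCommGroup F] [NormedSpace 𝕜 F]

/-- The inverse function theorem, with analyticity of the local inverse on its whole domain. -/
theorem exists_openPartialHomeomorph_of_contDiffAt {f : E → F} {f' : E ≃L[𝕜] F} {a : E}
    (hf : ContDiffAt 𝕜 ω f a) (hf' : HasFDerivAt f (f' : E →L[𝕜] F) a) :
    ∃ Φ : OpenPartialHomeomorph E F, a ∈ Φ.source ∧ (Φ : E → F) = f ∧
      ContDiffOn 𝕜 ω Φ Φ.source ∧ ContDiffOn 𝕜 ω Φ.symm Φ.target := by
  have hω : (ω : WithTop ℕ∞) ≠ 0 := by simp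
  let Φ₀ := hf.toOpenPartialHomeomorph f hf' hω
  have hcoe : (Φ₀ : E → F) = f := rfl
  have ha : a ∈ Φ₀.source := hf.mem_toOpenPartialHomeomorph_source hf' hω
  have hsymm : ContDiffAt 𝕜 ω Φ₀.symm (f a) := hf.to_localInverse hf' hω
  obtain ⟨O₁, hO₁, hO₁o, haO₁⟩ := eventually_nhds_iff.mp (hf.eventually (by simp))
  obtain ⟨O₂, hO₂, hO₂o, haO₂⟩ := eventually_nhds_iff.mp (hsymm.eventually (by simp))
  -- The source is shrunk until both the map and its inverse are analytic at every point of their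
  -- domains.
  let s := O₁ ∩ (Φ₀.source ∩ Φ₀ ⁻¹' O₂)
  have hs : IsOpen s := hO₁o.inter (Φ₀.isOpen_inter_preimage hO₂o)
  let Φ := Φ₀.restrOpen s hs
  have hsource : Φ.source = Φ₀.source ∩ s := Φ₀.restrOpen_source s hs
  refine ⟨Φ, ?_, rfl, ?_, ?_⟩
  · rw [hsource]
    exact ⟨ha, haO₁, ha, haO₂⟩
  · intro x hx
    rw [hsource] at hx
    exact (hO₁ x hx.2.1).contDiffWithinAt
  · intro y hy
    have h1 : Φ.symm y ∈ Φ.source := Φ.map_target hy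
    rw [hsource] at h1
    have h2 : Φ (Φ.symm y) = y := Φ.right_inv hy
    have h3 : Φ (Φ.symm y) ∈ O₂ := h1.2.2.2
    rw [h2] at h3
    exact (hO₂ y h3).contDiffWithinAt

end InverseFunction

/-! ### Orbits as zero sets of submersions -/

section OrbitChart

variable {𝕜 g : Type*} [RCLike 𝕜] [NormedLieRing g] [NormedLieAlgebra 𝕜 g]
  [FiniteDimensional 𝕜 g]
  {E : Type*} [NormedAddCommGroup E] [NormedSpace 𝕜 E] [FiniteDimensional 𝕜 E]

omit [FiniteDimensional 𝕜 E] in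
/-- The derivative of `(a, e) ↦ exp (ad a) (y + j e)` at the origin. -/
theorem hasStrictFDerivAt_expAd_apply_add (y : g) (D : Submodule 𝕜 g) (j : E →L[𝕜] g) :
    HasStrictFDerivAt (fun p : D × E => expAd 𝕜 (p.1 : g) (y + j p.2))
      ((((lieL 𝕜 g).flip y).comp D.subtypeL).coprod j) 0 := by
  let f : D × E →L[𝕜] g := D.subtypeL.comp (ContinuousLinearMap.fst 𝕜 D E)
  let k : D × E →L[𝕜] g := j.comp (ContinuousLinearMap.snd 𝕜 D E)
  have : CompleteSpace g := FiniteDimensional.complete 𝕜 g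
  have h1 : HasStrictFDerivAt (fun p => expAd 𝕜 (f p)) ((lieL 𝕜 g).comp f) 0 := by
    have h0 : HasStrictFDerivAt (NormedSpace.exp : (g →L[𝕜] g) → (g →L[𝕜] g))
        (1 : (g →L[𝕜] g) →L[𝕜] (g →L[𝕜] g)) (((lieL 𝕜 g).comp f) 0) := by
      rw [map_zero]
      exact hasStrictFDerivAt_exp_zero
    exact h0.comp 0 ((lieL 𝕜 g).comp f).hasStrictFDerivAt
  have h2 : HasStrictFDerivAt (fun p => y + k p) k 0 := k.hasStrictFDerivAt.const_add y
  refine (h1.clm_apply h2).congr_fderiv ?_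
  refine ContinuousLinearMap.ext fun p => ?_
  have e1 : expAd 𝕜 (f 0) = 1 := by rw [map_zero, expAd_zero]
  have e2 : y + k 0 = y := by rw [map_zero, add_zero]
  rw [e1, e2]
  simp [f, k, add_comm]

omit [FiniteDimensional 𝕜 E] in
theorem contDiff_expAd_apply_add (y : g) (D : Submodule 𝕜 g) (j : E →L[𝕜] g) :
    ContDiff 𝕜 ω (fun p : D × E => expAd 𝕜 (p.1 : g) (y + j p.2)) := by
  have h1 : ContDiff 𝕜 ω (fun p : D × E => expAd 𝕜 (p.1 : g)) :=
    contDiff_expAd.comp (D.subtypeL.contDiff.comp contDiff_fst)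
  exact h1.clm_apply (contDiff_const.add (j.contDiff.comp contDiff_snd))

/-- A transversal slice to an orbit is locally equivalent to the quotient by the orbits. -/
theorem exists_equiv_of_isCompl_range_ad {y : g} {D : Submodule 𝕜 g}
    (hD : IsCompl D (LinearMap.ker (LieAlgebra.ad 𝕜 g y))) {j : E →L[𝕜] g}
    (hj : Function.Injective j)
    (hE : IsCompl (LinearMap.range (LieAlgebra.ad 𝕜 g y)) (LinearMap.range j.toLinearMap)) :
    ∃ e : (D × E) ≃L[𝕜] g,
      (e : D × E →L[𝕜] g) = (((lieL 𝕜 g).flip y).comp D.subtypeL).coprod j := by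
  let ψ : D × E →L[𝕜] g := (((lieL 𝕜 g).flip y).comp D.subtypeL).coprod j
  have hψ : ∀ p : D × E, ψ p = ⁅(p.1 : g), y⁆ + j p.2 := fun p => rfl
  have hker : LinearMap.ker ψ.toLinearMap = ⊥ := by
    rw [LinearMap.ker_eq_bot']
    rintro ⟨d, e⟩ h
    have h' : ⁅(d : g), y⁆ + j e = 0 := h
    have h1 : j e = ⁅y, (d : g)⁆ := by
      rw [← lie_skew, ← add_eq_zero_iff_eq_neg, add_comm]
      exact h'
    have h2 : j e ∈ LinearMap.range (LieAlgebra.ad 𝕜 g y) ⊓ LinearMap.range j.toLinearMap :=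
      ⟨⟨d, h1.symm⟩, e, rfl⟩
    rw [hE.inf_eq_bot, Submodule.mem_bot] at h2
    have h3 : (d : g) ∈ D ⊓ LinearMap.ker (LieAlgebra.ad 𝕜 g y) :=
      ⟨d.2, LinearMap.mem_ker.mpr (h1.symm.trans h2)⟩
    rw [hD.inf_eq_bot, Submodule.mem_bot] at h3
    have h4 : e = 0 := hj (by rw [h2, map_zero])
    rw [h4, Subtype.ext (a1 := d) (a2 := 0) h3]
    rfl
  have hrank : Module.finrank 𝕜 (D × E) = Module.finrank 𝕜 g := by
    rw [Module.finrank_prod]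
    have h1 := Submodule.finrank_add_eq_of_isCompl hD
    have h2 := Submodule.finrank_add_eq_of_isCompl hE
    have h3 := LinearMap.finrank_range_add_finrank_ker (LieAlgebra.ad 𝕜 g y)
    have h4 : Module.finrank 𝕜 (LinearMap.range j.toLinearMap) = Module.finrank 𝕜 E :=
      LinearMap.finrank_range_of_inj hj
    omega
  refine ⟨(LinearEquiv.ofInjectiveOfFinrankEq ψ.toLinearMap (LinearMap.ker_eq_bot.mp hker)
    hrank).toContinuousLinearEquiv, ?_⟩
  ext <;> rfl

variable [LieAlgebra.IsKilling 𝕜 g]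

/-- Near `y`, the orbit of `y` is the zero set of a submersion to a given transversal space. -/
theorem exists_submersion_eq_zero_iff_mem_adjointOrbit (y : g) {j : E →L[𝕜] g}
    (hj : Function.Injective j)
    (hE : IsCompl (LinearMap.range (LieAlgebra.ad 𝕜 g y)) (LinearMap.range j.toLinearMap)) :
    ∃ (e : g → E) (e' : g →L[𝕜] E), ContDiffAt 𝕜 ω e y ∧ HasFDerivAt e e' y ∧
      (∀ v, e' (j v) = v) ∧ (∀ a, e' ⁅y, a⁆ = 0) ∧
      ∀ᶠ z in 𝓝 y, z ∈ adjointOrbit 𝕜 y ↔ e z = 0 := by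
  obtain ⟨D, hD'⟩ := Submodule.exists_isCompl (LinearMap.ker (LieAlgebra.ad 𝕜 g y))
  have hD := hD'.symm
  have : CompleteSpace D := FiniteDimensional.complete 𝕜 D
  have : CompleteSpace E := FiniteDimensional.complete 𝕜 E
  obtain ⟨ψ, hψ⟩ := exists_equiv_of_isCompl_range_ad hD hj hE
  have hψ' : ∀ p : D × E, ψ p = ⁅(p.1 : g), y⁆ + j p.2 := fun p => by
    change (ψ : D × E →L[𝕜] g) p = _
    rw [hψ]
    rfl
  have hder := (hasStrictFDerivAt_expAd_apply_add y D j).hasFDerivAt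
  rw [← hψ] at hder
  -- `Φ` is (a, e) ↦ exp(ad a)(y + j e); the submersion is the `E`-coordinate of its inverse.
  obtain ⟨Φ, h0, hΦ, -, hsymm⟩ := exists_openPartialHomeomorph_of_contDiffAt
    (contDiff_expAd_apply_add y D j).contDiffAt hder
  have hΦ' : ∀ p : D × E, Φ p = expAd 𝕜 (p.1 : g) (y + j p.2) := fun p => by rw [hΦ]
  have hΦ0 : Φ 0 = y := by rw [hΦ']; simp [expAd_zero]
  have hy : y ∈ Φ.target := by rw [← hΦ0]; exact Φ.map_source h0
  have hsymm0 : Φ.symm y = 0 := by rw [← hΦ0]; exact Φ.left_inv h0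
  have hcd : ContDiffAt 𝕜 ω Φ.symm y := hsymm.contDiffAt (Φ.open_target.mem_nhds hy)
  have hd : HasFDerivAt Φ.symm (ψ.symm : g →L[𝕜] D × E) y := by
    refine Φ.hasFDerivAt_symm hy ?_
    rw [hsymm0, hΦ]
    exact hder
  have hψs : ∀ p, ψ.symm (ψ p) = p := ψ.symm_apply_apply
  refine ⟨fun z => (Φ.symm z).2, (ContinuousLinearMap.snd 𝕜 D E).comp (ψ.symm : g →L[𝕜] D × E),
    hcd.snd, ?_,
    ?_, ?_, ?_⟩
  · exact (ContinuousLinearMap.snd 𝕜 D E).hasFDerivAt.comp y hd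
  · intro v
    have h1 : j v = ψ (0, v) := by rw [hψ']; simp
    change (ψ.symm (j v)).2 = v
    rw [h1, hψs]
  · intro a
    obtain ⟨d, hd, c, hc, hdc⟩ := Submodule.mem_sup.mp (hD.sup_eq_top ▸ Submodule.mem_top :
      a ∈ D ⊔ LinearMap.ker (LieAlgebra.ad 𝕜 g y))
    have hc' : ⁅y, c⁆ = 0 := hc
    have h1 : ⁅y, a⁆ = ψ (-⟨d, hd⟩, 0) := by
      rw [hψ', ← hdc, lie_add, hc', ← lie_skew]
      simp
    change (ψ.symm ⁅y, a⁆).2 = 0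
    rw [h1, hψs]
  -- Rigidity writes a nearby orbit point as exp(ad a) y with a ∈ D so small that (a, 0) is in the
  -- chart. This excludes other sheets of the orbit accumulating at y.
  · have hN : {a : D | (a, (0 : E)) ∈ Φ.source} ∈ 𝓝 (0 : D) := by
      have hc : ContinuousAt (fun a : D => (a, (0 : E))) 0 := by fun_prop
      exact hc (Φ.open_source.mem_nhds h0)
    filter_upwards [eventually_exists_expAd_eq_of_conj y hD hN, Φ.open_target.mem_nhds hy]
      with z hz hzt
    constructor
    · intro hzO
      obtain ⟨a, ha, hza⟩ := hz (exists_conj_of_mem_adjointOrbit hzO)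
      have h1 : z = Φ (a, 0) := by rw [hΦ', hza]; simp
      rw [h1, Φ.left_inv ha]
    · intro h2
      have h1 : z = Φ (Φ.symm z) := (Φ.right_inv hzt).symm
      rw [h1, hΦ', h2, map_zero, add_zero]
      exact expAd_mem_adjointOrbit _ _

end OrbitChart

/-! ### Embeddedness of the intersection of an orbit with the slice -/

section Submanifold

variable {𝕜 g : Type*} [RCLike 𝕜] [NormedLieRing g] [NormedLieAlgebra 𝕜 g]
  [FiniteDimensional 𝕜 g] [LieAlgebra.IsKilling 𝕜 g] {t0 tp tm : g}

/-- By transversality a complement `E` of `T` in g_lw is also a complement of im(ad y) in g, so the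
defining submersion of the orbit can take values in `E`. -/
theorem isSubmanifoldAt_orbitSlice (S : SliceLift 𝕜 tp tm) (ht : IsSl2Embedding t0 tp tm) {x : g}
    {w : lowestWeight 𝕜 tm} (hw : w ∈ orbitSlice 𝕜 tp tm x) :
    IsSubmanifoldAt (orbitSlice 𝕜 tp tm x) w (hamiltonianSpan (wBracket (𝕜 := 𝕜) tp tm) w) := by
  set T := hamiltonianSpan (wBracket (𝕜 := 𝕜) tp tm) w with hT
  have : CompleteSpace (lowestWeight 𝕜 tm) := FiniteDimensional.complete 𝕜 _
  obtain ⟨E, hE⟩ := Submodule.exists_isCompl T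
  set y := tp + (w : g) with hy
  have hTmem : ∀ v : lowestWeight 𝕜 tm, v ∈ T ↔ ∃ a : g, ⁅y, a⁆ = (v : g) := fun v =>
    S.mem_hamiltonianSpan_iff ht
  let j : E →L[𝕜] g := (lowestWeight 𝕜 tm).subtypeL.comp E.subtypeL
  have hjc : ∀ v : E, j v = ((v : lowestWeight 𝕜 tm) : g) := fun v => rfl
  have hj : Function.Injective j := Subtype.val_injective.comp Subtype.val_injective
  have hcompl : IsCompl (LinearMap.range (LieAlgebra.ad 𝕜 g y))
      (LinearMap.range j.toLinearMap) := by
    constructor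
    · rw [disjoint_iff, eq_bot_iff]
      rintro _ ⟨⟨a, ha⟩, ⟨v, rfl⟩⟩
      have h1 : (v : lowestWeight 𝕜 tm) ∈ T ⊓ E := ⟨(hTmem _).mpr ⟨a, ha⟩, v.2⟩
      rw [hE.inf_eq_bot, Submodule.mem_bot] at h1
      have h2 : v = 0 := Subtype.ext h1
      rw [h2, Submodule.mem_bot, map_zero]
    · rw [codisjoint_iff, eq_top_iff, ← ht.range_ad_sup_lowestWeight w]
      refine sup_le le_sup_left ?_
      intro v hv
      obtain ⟨t, ht', e, he, hte⟩ := Submodule.mem_sup.mp (hE.sup_eq_top ▸ Submodule.mem_top :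
        (⟨v, hv⟩ : lowestWeight 𝕜 tm) ∈ T ⊔ E)
      obtain ⟨a, ha⟩ := (hTmem t).mp ht'
      have hv' : v = (t : g) + (e : g) := (congrArg Subtype.val hte).symm
      rw [hv']
      exact Submodule.add_mem_sup ⟨a, ha⟩ ⟨⟨e, he⟩, rfl⟩
  obtain ⟨e, e', hes, hed, hej, hel, heO⟩ :=
    exists_submersion_eq_zero_iff_mem_adjointOrbit y hj hcompl
  let P : lowestWeight 𝕜 tm →L[𝕜] lowestWeight 𝕜 tm :=
    LinearMap.toContinuousLinearMap (T.projection E hE)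
  have hPT : ∀ v, P v ∈ T := fun v => T.projection_apply_mem hE v
  have hP1 : ∀ v ∈ T, P v = v := fun v hv => T.projection_apply_of_mem_left hE hv
  have hP2 : ∀ v ∈ E, P v = 0 := fun v hv => T.projection_apply_of_mem_right hE hv
  -- The `T`-component is kept and the `E`-component replaced by the defining equation `e`; the
  -- differential at w is the identity.
  let f : lowestWeight 𝕜 tm → lowestWeight 𝕜 tm := fun v =>
    P (v - w) + E.subtypeL (e (tp + (v : g)))
  have hs1 : HasFDerivAt (fun v : lowestWeight 𝕜 tm => tp + (v : g))
      (lowestWeight 𝕜 tm).subtypeL w := ((lowestWeight 𝕜 tm).subtypeL.hasFDerivAt).const_add tp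
  have hs2 : ContDiff 𝕜 ω (fun v : lowestWeight 𝕜 tm => tp + (v : g)) :=
    contDiff_const.add (lowestWeight 𝕜 tm).subtypeL.contDiff
  have hfs : ContDiffAt 𝕜 ω f w := by
    have h1 : ContDiffAt 𝕜 ω (fun v : lowestWeight 𝕜 tm => P (v - w)) w :=
      (P.contDiff.comp (contDiff_id.sub contDiff_const)).contDiffAt
    have h2 : ContDiffAt 𝕜 ω (fun v : lowestWeight 𝕜 tm => e (tp + (v : g))) w :=
      ContDiffAt.comp (g := e) w hes hs2.contDiffAt
    exact h1.add (E.subtypeL.contDiff.contDiffAt.comp w h2)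
  have hfd : HasFDerivAt f (ContinuousLinearEquiv.refl 𝕜 (lowestWeight 𝕜 tm) :
      lowestWeight 𝕜 tm →L[𝕜] lowestWeight 𝕜 tm) w := by
    have h1 : HasFDerivAt (fun v : lowestWeight 𝕜 tm => P (v - w)) P w :=
      P.hasFDerivAt.comp w ((hasFDerivAt_id w).sub_const w)
    have h2 : HasFDerivAt (fun v : lowestWeight 𝕜 tm => e (tp + (v : g)))
        (e'.comp (lowestWeight 𝕜 tm).subtypeL) w := HasFDerivAt.comp (g := e) w hed hs1
    refine (h1.add (E.subtypeL.hasFDerivAt.comp w h2)).congr_fderiv ?_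
    refine ContinuousLinearMap.ext fun v => ?_
    change P v + (e' (v : g) : lowestWeight 𝕜 tm) = v
    obtain ⟨t, ht', u, hu, rfl⟩ := Submodule.mem_sup.mp (hE.sup_eq_top ▸ Submodule.mem_top :
        v ∈ T ⊔ E)
    obtain ⟨a, ha⟩ := (hTmem t).mp ht'
    have h3 : e' ((t + u : lowestWeight 𝕜 tm) : g) = ⟨u, hu⟩ := by
      rw [Submodule.coe_add, map_add, ← ha, hel, zero_add]
      exact hej ⟨u, hu⟩
    rw [h3, map_add, hP1 t ht', hP2 u hu, add_zero]
  obtain ⟨Φ₀, hw₀, hΦ₀, h1, h2⟩ := exists_openPartialHomeomorph_of_contDiffAt hfs hfd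
  have hev : ∀ᶠ v in 𝓝 w, tp + ((v : lowestWeight 𝕜 tm) : g) ∈ adjointOrbit 𝕜 y ↔
      e (tp + (v : g)) = 0 := hs1.continuousAt.eventually heO
  obtain ⟨O, hO, hOo, hwO⟩ := eventually_nhds_iff.mp hev
  let Φ := Φ₀.restrOpen O hOo
  have hsource : Φ.source = Φ₀.source ∩ O := Φ₀.restrOpen_source O hOo
  have htarget : Φ.target ⊆ Φ₀.target := fun z hz => hz.1
  have hcoe : (Φ : _ → _) = f := hΦ₀
  refine ⟨Φ, T, ?_, ?_, ?_, ?_, ?_⟩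
  · rw [hsource]; exact ⟨hw₀, hwO⟩
  · exact (h1.mono (by rw [hsource]; exact Set.inter_subset_left)).of_le le_top
  · exact (h2.mono htarget).of_le le_top
  · intro v hv
    rw [hsource] at hv
    have hOrb : adjointOrbit 𝕜 y = adjointOrbit 𝕜 x := adjointOrbit_eq_of_mem hw
    change tp + (v : g) ∈ adjointOrbit 𝕜 x ↔ _
    rw [← hOrb, hO v hv.2, hcoe]
    change _ ↔ P (v - w) + (e (tp + (v : g)) : lowestWeight 𝕜 tm) ∈ T
    rw [Submodule.add_mem_iff_right T (hPT _)]
    constructor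
    · intro h; rw [h]; exact zero_mem _
    · intro h
      have h3 : (e (tp + (v : g)) : lowestWeight 𝕜 tm) ∈ T ⊓ E := ⟨h, (e (tp + (v : g))).2⟩
      rw [hE.inf_eq_bot, Submodule.mem_bot] at h3
      exact Subtype.ext h3
  · rw [hcoe, hfd.fderiv]
    rfl

theorem isSymplecticSubmanifold_orbitSlice (S : SliceLift 𝕜 tp tm) (ht : IsSl2Embedding t0 tp tm)
    (x : g) : IsSymplecticSubmanifold (wBracket (𝕜 := 𝕜) tp tm) (orbitSlice 𝕜 tp tm x) :=
  fun w hw => ⟨isSubmanifoldAt_orbitSlice S ht hw, S.isNondegenerateOn ht w⟩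

end Submanifold

open Set
open scoped NNReal

/-! ### Lax equations preserve similarity -/

section LinearODE

open Metric

/-- Picard–Lindelöf, retaining that the solution stays in the ball; this will give invertibility. -/
theorem exists_solution_mem_closedBall {E : Type*} [NormedAddCommGroup E] [NormedSpace ℝ E]
    [CompleteSpace E] {f : ℝ → E → E} {tmin tmax : ℝ} {t₀ : Icc tmin tmax} {x₀ x : E}
    {a r L K : ℝ≥0} (hf : IsPicardLindelof f t₀ x₀ a r L K) (hx : x ∈ closedBall x₀ r) :
    ∃ α : ℝ → E, α t₀ = x ∧
      (∀ t ∈ Icc tmin tmax, HasDerivWithinAt α (f t (α t)) (Icc tmin tmax) t) ∧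
      ∀ t ∈ Icc tmin tmax, α t ∈ closedBall x₀ a := by
  obtain ⟨α, hα⟩ := ODE.FunSpace.exists_isFixedPt_next hf hx
  have hmem : ∀ t, α.compProj t ∈ closedBall x₀ a := fun t =>
    α.compProj_mem_closedBall hf.mul_max_le
  refine ⟨α.compProj, ?_, fun t ht => ?_, fun t _ => hmem t⟩
  · rw [ODE.FunSpace.compProj_val, ← hα, ODE.FunSpace.next_apply₀]
  · refine (ODE.hasDerivWithinAt_picard_Icc t₀.2 hf.continuousOn_uncurry
      α.continuous_compProj.continuousOn (fun t _ => hmem t) x ht).congr_of_mem ?_ ht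
    intro t' ht'
    nth_rw 1 [← hα]
    rw [ODE.FunSpace.compProj_of_mem ht', ODE.FunSpace.next_apply]

/-- A solution of a Lax equation `Y' = Y B - B Y` stays in one similarity class, for short times. -/
theorem exists_unit_mul_eq_of_lax {A : Type*} [NormedRing A] [NormedAlgebra ℝ A] [CompleteSpace A]
    {Y B : ℝ → A} {s t M : ℝ} (hst : s ≤ t) (hM : 0 ≤ M)
    (hB : ContinuousOn B (Icc s t)) (hBM : ∀ r ∈ Icc s t, ‖B r‖ ≤ M)
    (hY : ∀ r ∈ Icc s t, HasDerivWithinAt Y (Y r * B r - B r * Y r) (Icc s t) r)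
    (hshort : (‖(1 : A)‖ + 1) * M * (t - s) ≤ 1 / 2) :
    ∃ u : Aˣ, (u : A) * Y t = Y s * u := by
  -- Solve U' = U B from U(s) = 1 inside the ball of radius 1/2, where U is invertible and ‖U‖ ≤ ‖1‖
  -- + 1; `hshort` keeps the solution there.
  have hpl : IsPicardLindelof (fun r (U : A) => U * B r) (tmin := s) (tmax := t)
      ⟨s, left_mem_Icc.mpr hst⟩ 1 (1 / 2) 0 ⟨(‖(1 : A)‖ + 1) * M, by positivity⟩ ⟨M, hM⟩ := by
    constructor
    · intro r hr
      refine LipschitzOnWith.of_dist_le_mul fun U _ U' _ => ?_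
      rw [dist_eq_norm, dist_eq_norm, ← sub_mul]
      refine (norm_mul_le (U - U') (B r)).trans ?_
      rw [mul_comm]
      exact mul_le_mul_of_nonneg_right (hBM r hr) (norm_nonneg _)
    · intro U _
      exact continuousOn_const.mul hB
    · intro r hr U hU
      refine (norm_mul_le _ _).trans ?_
      refine mul_le_mul ?_ (hBM r hr) (norm_nonneg _) (by positivity)
      have h1 : ‖U - 1‖ ≤ 1 / 2 := by simpa [dist_eq_norm] using hU
      have h2 : ‖U‖ ≤ ‖(1 : A)‖ + ‖U - 1‖ := by
        simpa using norm_add_le (1 : A) (U - 1)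
      linarith
    · simp only [sub_self, NNReal.coe_zero, sub_zero]
      rw [max_eq_left (sub_nonneg.mpr hst)]
      exact hshort.trans (by norm_num)
  obtain ⟨U, hU0, hU, hUmem⟩ := exists_solution_mem_closedBall hpl (mem_closedBall_self le_rfl)
  have hU0 : U s = 1 := hU0
  have hderiv : ∀ {Z Z' : ℝ → A}, (∀ r ∈ Icc s t, HasDerivWithinAt Z (Z' r) (Icc s t) r) →
      ∀ r ∈ Ico s t, HasDerivWithinAt Z (Z' r) (Ici r) r := by
    intro Z Z' hZ r hr
    exact (hZ r (Ico_subset_Icc_self hr)).mono_of_mem_nhdsWithin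
      (Icc_mem_nhdsGE_of_mem hr)
  have hbound : ∀ {Z : ℝ → A}, (∀ r ∈ Icc s t, HasDerivWithinAt Z (Z r * B r) (Icc s t) r) →
      Z s = 0 → ∀ r ∈ Icc s t, Z r = 0 := by
    intro Z hZ h0
    refine eq_zero_of_abs_deriv_le_mul_abs_self_of_eq_zero_right (K := M)
      (fun r hr => (hZ r hr).continuousWithinAt) (hderiv hZ) h0 fun r hr => ?_
    refine (norm_mul_le _ _).trans ?_
    rw [mul_comm]
    exact mul_le_mul_of_nonneg_right (hBM r (Ico_subset_Icc_self hr)) (norm_nonneg _)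
  -- Z = U Y - Y(s) U solves Z' = Z B with Z(s) = 0.
  have hconj : U t * Y t - Y s * U t = 0 := by
    refine hbound (Z := fun r => U r * Y r - Y s * U r) (fun r hr => ?_) ?_ t
      (right_mem_Icc.mpr hst)
    · refine (((hU r hr).mul (hY r hr)).sub ((hU r hr).const_mul (Y s))).congr_deriv ?_
      noncomm_ring
    · simp [hU0]
  have hU1 : ‖1 - U t‖ < 1 := by
    have h1 := hUmem t (right_mem_Icc.mpr hst)
    rw [mem_closedBall, dist_eq_norm, norm_sub_rev] at h1
    refine h1.trans_lt ?_
    norm_num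
  refine ⟨Units.oneSub (1 - U t) hU1, ?_⟩
  rw [Units.val_oneSub, sub_sub_cancel]
  exact sub_eq_zero.mp hconj

end LinearODE

/-! ### Endpoints of integral curves depending on a parameter -/

section Endpoint

open Metric

variable {V T : Type*} [NormedAddCommGroup V] [NormedSpace ℝ V] [CompleteSpace V]
  [NormedAddCommGroup T] [NormedSpace ℝ T] [CompleteSpace T]

/-- The endpoints of the integral curves of the vector fields `z ↦ B z v` starting at `w` depend
strictly differentiably on the parameter `v`. -/
theorem exists_hasStrictFDerivAt_endpoint {B : V → T →L[ℝ] V} {w : V} (hB : ContDiffAt ℝ 1 B w) :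
    ∃ (ε : ℝ) (G : T → V), 0 < ε ∧ G 0 = w ∧ HasStrictFDerivAt G (ε • B w) 0 ∧
      ∀ᶠ v in 𝓝 (0 : T), ∃ γ : ℝ → V, γ 0 = w ∧ γ ε = G v ∧
        ∀ t ∈ Icc 0 ε, HasDerivWithinAt γ (B (γ t) v) (Icc 0 ε) t := by
  -- The parameter becomes a constant coordinate, so a single local flow covers all small `v` up to
  -- a common time ε.
  let F : V × T → V × T := fun p => (B p.1 p.2, 0)
  have hF : ContDiffAt ℝ 1 F (w, 0) := by
    have h1 : ContDiffAt ℝ 1 (fun p : V × T => B p.1) (w, 0) :=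
      ContDiffAt.comp (g := B) (w, (0 : T)) hB contDiffAt_fst
    exact (h1.clm_apply contDiffAt_snd).prodMk contDiffAt_const
  obtain ⟨ε, hε, a, r, L, K, hr, hpl⟩ := IsPicardLindelof.of_contDiffAt_one hF
  obtain ⟨α, hα, L', hL'⟩ :=
    (hpl 0).exists_forall_mem_closedBall_eq_hasDerivWithinAt_lipschitzOnWith
  obtain ⟨K', s, hs, hlip⟩ := hB.exists_lipschitzOnWith
  obtain ⟨ρ, hρ, hρs⟩ := Metric.mem_nhds_iff.mp hs
  have hsub : Icc 0 ε ⊆ Icc (0 - ε) (0 + ε) := Icc_subset_Icc (by linarith) (by linarith)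
  have hr' : (0 : ℝ) < r := hr
  have hmem : ∀ v : T, ‖v‖ ≤ r → (w, v) ∈ closedBall (w, (0 : T)) r := by
    intro v hv
    rw [mem_closedBall, Prod.dist_eq]
    simpa using hv
  let γ : T → ℝ → V := fun v t => (α (w, v) t).1
  have hγ : ∀ v : T, ‖v‖ ≤ r → γ v 0 = w ∧
      ∀ t ∈ Icc 0 ε, HasDerivWithinAt (γ v) (B (γ v t) v) (Icc 0 ε) t := by
    intro v hv
    obtain ⟨h0, h1⟩ := hα (w, v) (hmem v hv)
    have h0 : α (w, v) 0 = (w, v) := h0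
    have h2 : ∀ t ∈ Icc 0 ε, HasDerivWithinAt (α (w, v)) (F (α (w, v) t)) (Icc 0 ε) t :=
      fun t ht => (h1 t (hsub ht)).mono hsub
    have h3 : ∀ t ∈ Icc 0 ε, (α (w, v) t).2 = v := by
      intro t ht
      have h4 := (convex_Icc 0 ε).norm_image_sub_le_of_norm_hasDerivWithin_le
        (f := fun t => (α (w, v) t).2) (f' := fun _ => 0) (C := 0)
        (fun t ht => (h2 t ht).snd) (by simp) (left_mem_Icc.mpr hε.le) ht
      rw [zero_mul, norm_le_zero_iff, sub_eq_zero] at h4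
      rw [h4, h0]
    refine ⟨congrArg Prod.fst h0, fun t ht => ?_⟩
    have h5 : HasDerivWithinAt (γ v) (B (γ v t) (α (w, v) t).2) (Icc 0 ε) t := (h2 t ht).fst
    rwa [h3 t ht] at h5
  have hγL : ∀ v v' : T, ‖v‖ ≤ r → ‖v'‖ ≤ r → ∀ t ∈ Icc 0 ε,
      ‖γ v t - γ v' t‖ ≤ L' * ‖v - v'‖ := by
    intro v v' hv hv' t ht
    have h1 := (hL' t (hsub ht)).dist_le_mul _ (hmem v hv) _ (hmem v' hv')
    rw [Prod.dist_eq, Prod.dist_eq] at h1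
    simp only [dist_self, dist_eq_norm] at h1
    rw [max_eq_right (norm_nonneg _)] at h1
    exact (le_max_left _ _).trans h1
  have hγ0 : ∀ t ∈ Icc 0 ε, γ 0 t = w := by
    intro t ht
    obtain ⟨h0, h1⟩ := hγ 0 (by simp)
    have h4 := (convex_Icc 0 ε).norm_image_sub_le_of_norm_hasDerivWithin_le (C := 0) h1
      (by simp) (left_mem_Icc.mpr hε.le) ht
    rw [zero_mul, norm_le_zero_iff, sub_eq_zero] at h4
    rw [h4, h0]
  have hε' : ε ∈ Icc 0 ε := right_mem_Icc.mpr hε.le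
  refine ⟨ε, fun v => γ v ε, hε, hγ0 ε hε', ?_, ?_⟩
  · have hsmall : ∀ᶠ v in 𝓝 (0 : T), ‖v‖ ≤ r ∧ L' * ‖v‖ < ρ := by
      have c : Continuous fun v : T => (L' : ℝ) * ‖v‖ := by fun_prop
      refine (Metric.eventually_nhds_iff.mpr ⟨r, hr', fun v hv => ?_⟩).and
        (c.continuousAt.eventually_lt_const (by simpa using hρ))
      rw [dist_zero_right] at hv
      exact hv.le
    -- Lipschitz dependence of the flow suffices: the vector field is linear in `v` and vanishes at
    -- v = 0, so the error is o(‖v - v'‖), which is strict differentiability at 0.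
    have hest : ∀ v v' : T, (‖v‖ ≤ r ∧ L' * ‖v‖ < ρ) → (‖v'‖ ≤ r ∧ L' * ‖v'‖ < ρ) →
        ‖γ v ε - γ v' ε - (ε • B w) (v - v')‖ ≤ K' * L' * ε * (‖v‖ + ‖v'‖) * ‖v - v'‖ := by
      rintro v v' ⟨hv, hvρ⟩ ⟨hv', hvρ'⟩
      have hdist : ∀ v : T, ‖v‖ ≤ r → L' * ‖v‖ < ρ → ∀ t ∈ Icc 0 ε,
          ‖γ v t - w‖ ≤ L' * ‖v‖ ∧ γ v t ∈ s := by
        intro v hv hvρ t ht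
        have h1 := hγL v 0 hv (by simp) t ht
        rw [hγ0 t ht, sub_zero] at h1
        refine ⟨h1, hρs ?_⟩
        rw [mem_ball, dist_eq_norm]
        exact h1.trans_lt hvρ
      have hd : ∀ t ∈ Icc 0 ε, HasDerivWithinAt (fun t => γ v t - γ v' t - t • B w (v - v'))
          (B (γ v t) v - B (γ v' t) v' - B w (v - v')) (Icc 0 ε) t := by
        intro t ht
        have h1 : HasDerivWithinAt (fun t : ℝ => t • B w (v - v')) ((1 : ℝ) • B w (v - v'))
            (Icc 0 ε) t := (hasDerivWithinAt_id t _).smul_const _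
        rw [one_smul] at h1
        exact (((hγ v hv).2 t ht).sub ((hγ v' hv').2 t ht)).sub h1
      have hb : ∀ t ∈ Icc 0 ε, ‖B (γ v t) v - B (γ v' t) v' - B w (v - v')‖ ≤
          K' * L' * (‖v‖ + ‖v'‖) * ‖v - v'‖ := by
        intro t ht
        obtain ⟨h1, h1s⟩ := hdist v hv hvρ t ht
        obtain ⟨-, h2s⟩ := hdist v' hv' hvρ' t ht
        have h3 : B (γ v t) v - B (γ v' t) v' - B w (v - v') =
            (B (γ v t) - B w) (v - v') + (B (γ v t) - B (γ v' t)) v' := by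
          simp only [map_sub, _root_.sub_apply]
          abel
        have h4 : ‖B (γ v t) - B w‖ ≤ K' * (L' * ‖v‖) :=
          (hlip.norm_sub_le h1s (mem_of_mem_nhds hs)).trans
            (mul_le_mul_of_nonneg_left h1 K'.2)
        have h5 : ‖B (γ v t) - B (γ v' t)‖ ≤ K' * (L' * ‖v - v'‖) :=
          (hlip.norm_sub_le h1s h2s).trans
            (mul_le_mul_of_nonneg_left (hγL v v' hv hv' t ht) K'.2)
        rw [h3]
        calc _ ≤ ‖B (γ v t) - B w‖ * ‖v - v'‖ + ‖B (γ v t) - B (γ v' t)‖ * ‖v'‖ :=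
              (norm_add_le _ _).trans (add_le_add (ContinuousLinearMap.le_opNorm _ _)
                (ContinuousLinearMap.le_opNorm _ _))
          _ ≤ K' * (L' * ‖v‖) * ‖v - v'‖ + K' * (L' * ‖v - v'‖) * ‖v'‖ := by gcongr
          _ = _ := by ring
      have h6 := (convex_Icc 0 ε).norm_image_sub_le_of_norm_hasDerivWithin_le hd hb
        (left_mem_Icc.mpr hε.le) hε'
      rw [(hγ v hv).1, (hγ v' hv').1, sub_self, zero_smul, sub_self, sub_zero, sub_zero,
        Real.norm_of_nonneg hε.le] at h6
      refine h6.trans (le_of_eq ?_)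
      ring
    rw [hasStrictFDerivAt_iff_isLittleO, Asymptotics.isLittleO_iff]
    intro c hc
    have hev : ∀ᶠ p : T × T in 𝓝 (0, 0), K' * L' * ε * (‖p.1‖ + ‖p.2‖) < c := by
      have c' : Continuous fun p : T × T => K' * L' * ε * (‖p.1‖ + ‖p.2‖) := by fun_prop
      exact c'.continuousAt.eventually_lt_const (by simpa using hc)
    filter_upwards [hev, hsmall.prod_nhds hsmall] with p hp1 hp2
    exact (hest p.1 p.2 hp2.1 hp2.2).trans
      (mul_le_mul_of_nonneg_right hp1.le (norm_nonneg _))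
  · refine Metric.eventually_nhds_iff.mpr ⟨r, hr', fun v hv => ?_⟩
    rw [dist_zero_right] at hv
    exact ⟨γ v, (hγ v hv.le).1, rfl, (hγ v hv.le).2⟩

end Endpoint

/-! ### Filling a neighbourhood in a submanifold by curves -/

section Transitivity

variable {𝕜 V : Type*} [RCLike 𝕜] [NormedAddCommGroup V] [NormedSpace 𝕜 V]
  [FiniteDimensional 𝕜 V] [NormedSpace ℝ V] [IsScalarTower ℝ 𝕜 V]

/-- If the vector fields `z ↦ B z v` span the tangent space at `w` of a submanifold that contains
their integral curves, then these curves fill a neighbourhood of `w` in the submanifold. -/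
theorem IsSubmanifoldAt.eventually_exists_curve {N : Set V} {w : V} {T : Submodule 𝕜 V}
    (hN : IsSubmanifoldAt N w T) {B : V → T →L[𝕜] V} (hB : ContDiff 𝕜 1 B)
    (hBw : B w = T.subtypeL)
    (hinv : ∀ (v : T) (ε : ℝ) (γ : ℝ → V), 0 ≤ ε → γ 0 = w →
      (∀ t ∈ Icc 0 ε, HasDerivWithinAt γ (B (γ t) v) (Icc 0 ε) t) → γ ε ∈ N) :
    ∀ᶠ z in 𝓝 w, z ∈ N → ∃ (v : T) (ε : ℝ) (γ : ℝ → V), 0 ≤ ε ∧ γ 0 = w ∧ γ ε = z ∧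
      ∀ t ∈ Icc 0 ε, HasDerivWithinAt γ (B (γ t) v) (Icc 0 ε) t := by
  obtain ⟨Φ, W, hw, hΦ, hΦs, hΦN, hT⟩ := hN
  have : CompleteSpace V := FiniteDimensional.complete 𝕜 V
  have : CompleteSpace T := FiniteDimensional.complete 𝕜 T
  have : CompleteSpace W := FiniteDimensional.complete 𝕜 W
  obtain ⟨C, hC⟩ := Submodule.exists_isCompl W
  let p : V →L[𝕜] W := LinearMap.toContinuousLinearMap (W.projectionOnto C hC)
  have hp : ∀ v : W, p v = v := fun v => W.projectionOnto_apply_left hC v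
  have hΦw : HasStrictFDerivAt Φ (fderiv 𝕜 Φ w) w :=
    (hΦ.contDiffAt (Φ.open_source.mem_nhds hw)).hasStrictFDerivAt (by simp)
  have hsurj : ∀ u, ∃ v, fderiv 𝕜 Φ w v = u := by
    intro u
    have h1 : HasFDerivAt Φ.symm (fderiv 𝕜 Φ.symm (Φ w)) (Φ w) :=
      ((hΦs.contDiffAt (Φ.open_target.mem_nhds (Φ.map_source hw))).differentiableAt
        (by simp)).hasFDerivAt
    have h2 : HasFDerivAt Φ (fderiv 𝕜 Φ w) (Φ.symm (Φ w)) := by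
      rw [Φ.left_inv hw]; exact hΦw.hasFDerivAt
    have h3 := h2.comp (Φ w) h1
    have h4 : (Φ ∘ Φ.symm) =ᶠ[𝓝 (Φ w)] id := by
      filter_upwards [Φ.open_target.mem_nhds (Φ.map_source hw)] with z hz
      exact Φ.right_inv hz
    have h5 := (h3.congr_of_eventuallyEq h4.symm).unique (hasFDerivAt_id _)
    exact ⟨_, DFunLike.congr_fun h5 u⟩
  have hBr : ContDiffAt ℝ 1 (fun z => (B z).restrictScalars ℝ) w :=
    ((ContinuousLinearMap.restrictScalarsL 𝕜 T V ℝ ℝ).contDiff.comp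
      (hB.restrict_scalars ℝ)).contDiffAt
  obtain ⟨ε, G, hε, hG0, hG, hGγ⟩ := exists_hasStrictFDerivAt_endpoint hBr
  have hΦr : HasStrictFDerivAt Φ ((fderiv 𝕜 Φ w).restrictScalars ℝ) (G 0) := by
    rw [hG0]; exact hΦw.restrictScalars ℝ
  have hpr : HasStrictFDerivAt p (p.restrictScalars ℝ) (Φ (G 0)) :=
    (p.restrictScalars ℝ).hasStrictFDerivAt
  have hall := hpr.comp (0 : T) (hΦr.comp (0 : T) hG)
  have hrange : LinearMap.range ((p.restrictScalars ℝ).comp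
      (((fderiv 𝕜 Φ w).restrictScalars ℝ).comp (ε • (B w).restrictScalars ℝ)) : T →ₗ[ℝ] W) = ⊤ := by
    rw [LinearMap.range_eq_top]
    intro u
    obtain ⟨v, hv⟩ := hsurj u
    have hvT : v ∈ T := by
      rw [hT, Submodule.mem_comap]
      change fderiv 𝕜 Φ w v ∈ W
      rw [hv]
      exact u.2
    refine ⟨ε⁻¹ • ⟨v, hvT⟩, ?_⟩
    change p (fderiv 𝕜 Φ w (ε • B w (ε⁻¹ • ⟨v, hvT⟩))) = u
    have h1 : ε • B w (ε⁻¹ • ⟨v, hvT⟩) = v := by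
      rw [hBw]
      change ε • (ε⁻¹ • v) = v
      rw [smul_smul, mul_inv_cancel₀ hε.ne', one_smul]
    rw [h1, hv, hp]
  -- In the straightened chart, projected to `W`, the endpoint map is onto a neighbourhood.
  have hmap := hall.map_nhds_eq_of_surj hrange
  have hGsource : ∀ᶠ v in 𝓝 (0 : T), G v ∈ Φ.source := by
    refine hG.continuousAt.eventually (Φ.open_source.mem_nhds ?_)
    rw [hG0]; exact hw
  have himage := (hGsource.and hGγ)
  have hev : ∀ᶠ u in 𝓝 (p (Φ w)), ∃ v : T, p (Φ (G v)) = u ∧ G v ∈ Φ.source ∧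
      ∃ γ : ℝ → V, γ 0 = w ∧ γ ε = G v ∧
        ∀ t ∈ Icc 0 ε, HasDerivWithinAt γ (B (γ t) v) (Icc 0 ε) t := by
    have h1 : 𝓝 (p (Φ w)) = map (p ∘ Φ ∘ G) (𝓝 0) := by
      rw [← hG0]; exact hmap.symm
    rw [h1, eventually_map]
    filter_upwards [himage] with v hv
    exact ⟨v, rfl, hv⟩
  have hcont : ContinuousAt (fun z => p (Φ z)) w :=
    p.continuous.continuousAt.comp hΦw.continuousAt
  filter_upwards [hcont.eventually hev, Φ.open_source.mem_nhds hw] with z hz hzs hzN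
  obtain ⟨v, hv, hvs, γ, h0, h1, hγ⟩ := hz
  refine ⟨v, ε, γ, hε.le, h0, ?_, hγ⟩
  -- Both `G v` and `z` lie in `N`, where `Φ` takes values in `W`; there `p` loses nothing, so equal
  -- projections give equal points.
  have hGN : G v ∈ N := h1 ▸ hinv v ε γ hε.le h0 hγ
  have e1 : (p (Φ (G v)) : V) = Φ (G v) := congrArg Subtype.val (hp ⟨_, (hΦN _ hvs).mp hGN⟩)
  have e2 : (p (Φ z) : V) = Φ z := congrArg Subtype.val (hp ⟨_, (hΦN _ hzs).mp hzN⟩)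
  rw [h1]
  refine Φ.injOn hvs hzs ?_
  rw [← e1, ← e2, hv]

end Transitivity

/-! ### Curves with y' = [y, a] stay in an orbit -/

section Lax

/-- The image in an algebra of a curve with `y' = [y, b]` stays locally in one similarity class. -/
theorem exists_forall_exists_unit_mul_eq {𝕜 V A : Type*} [RCLike 𝕜] [NormedAddCommGroup V]
    [NormedSpace 𝕜 V] [NormedSpace ℝ V] [IsScalarTower ℝ 𝕜 V] [NormedRing A] [NormedAlgebra 𝕜 A]
    [CompleteSpace A] (f : V →L[𝕜] A)
    {y y' b : ℝ → V} {T : ℝ} (hy : ∀ t ∈ Icc 0 T, HasDerivWithinAt y (y' t) (Icc 0 T) t)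
    (hb : ContinuousOn b (Icc 0 T))
    (hlax : ∀ t ∈ Icc 0 T, f (y' t) = f (y t) * f (b t) - f (b t) * f (y t)) :
    ∃ δ > 0, ∀ s ∈ Icc 0 T, ∀ t ∈ Icc 0 T, s ≤ t → t - s ≤ δ →
      ∃ u : Aˣ, (u : A) * f (y t) = f (y s) * u := by
  let := NormedAlgebra.restrictScalars ℝ 𝕜 A
  have : IsScalarTower ℝ 𝕜 A := IsScalarTower.of_algebraMap_smul fun r x => rfl
  have hB : ContinuousOn (fun t => f (b t)) (Icc 0 T) := f.continuous.comp_continuousOn hb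
  obtain ⟨M, hM⟩ := isCompact_Icc.exists_bound_of_continuousOn hB
  set M' := max M 0
  set c := (‖(1 : A)‖ + 1) * M' with hc
  have hc0 : 0 ≤ c := by positivity
  refine ⟨1 / (2 * (c + 1)), by positivity, fun s hs t ht hst hδ => ?_⟩
  have hsub : Icc s t ⊆ Icc 0 T := Icc_subset_Icc hs.1 ht.2
  refine exists_unit_mul_eq_of_lax (Y := fun t => f (y t)) (B := fun t => f (b t)) hst
    (le_max_right M 0) (hB.mono hsub) (fun r hr => (hM r (hsub hr)).trans (le_max_left _ _)) ?_ ?_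
  · intro r hr
    have h1 := (f.restrictScalars ℝ).hasFDerivAt.comp_hasDerivWithinAt r
      ((hy r (hsub hr)).mono hsub)
    refine h1.congr_deriv ?_
    exact hlax r (hsub hr)
  · refine (mul_le_mul_of_nonneg_left hδ hc0).trans ?_
    rw [mul_one_div, div_le_div_iff₀ (by positivity) (by norm_num)]
    linarith

variable {𝕜 g : Type*} [RCLike 𝕜] [NormedLieRing g] [NormedLieAlgebra 𝕜 g]
  [FiniteDimensional 𝕜 g] [LieAlgebra.IsKilling 𝕜 g] [NormedSpace ℝ g] [IsScalarTower ℝ 𝕜 g]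

omit [LieAlgebra.IsKilling 𝕜 g] [NormedSpace ℝ g] [IsScalarTower ℝ 𝕜 g] in
theorem lieL_lie (x y : g) :
    lieL 𝕜 g ⁅x, y⁆ = lieL 𝕜 g x * lieL 𝕜 g y - lieL 𝕜 g y * lieL 𝕜 g x :=
  ContinuousLinearMap.ext fun z => lie_lie x y z

/-- A curve with `y' = [y, a]` stays in one orbit. -/
theorem mem_adjointOrbit_of_hasDerivWithinAt {y a : ℝ → g} {T : ℝ}
    (hy : ∀ t ∈ Icc 0 T, HasDerivWithinAt y ⁅y t, a t⁆ (Icc 0 T) t)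
    (ha : ContinuousOn a (Icc 0 T)) {s t : ℝ} (hs : s ∈ Icc 0 T) (ht : t ∈ Icc 0 T) :
    y t ∈ adjointOrbit 𝕜 (y s) := by
  have : CompleteSpace g := FiniteDimensional.complete 𝕜 g
  obtain ⟨δ, hδ, hconj⟩ : ∃ δ > 0, ∀ s ∈ Icc 0 T, ∀ t ∈ Icc 0 T, s ≤ t → t - s ≤ δ →
      ∃ u : (g →L[𝕜] g)ˣ, (u : g →L[𝕜] g) * lieL 𝕜 g (y t) = lieL 𝕜 g (y s) * u := by
    exact exists_forall_exists_unit_mul_eq (lieL 𝕜 g) hy ha fun t _ => lieL_lie _ _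
  have hconj' : ∀ s ∈ Icc 0 T, ∀ t ∈ Icc 0 T, |t - s| ≤ δ →
      ∃ u : (g →L[𝕜] g)ˣ, (u : g →L[𝕜] g) * lieL 𝕜 g (y s) = lieL 𝕜 g (y t) * u := by
    intro s hs t ht hst
    rcases le_total s t with h | h
    · obtain ⟨u, hu⟩ := hconj s hs t ht h (by rwa [abs_of_nonneg (sub_nonneg.mpr h)] at hst)
      refine ⟨u⁻¹, ?_⟩
      rw [Units.inv_mul_eq_iff_eq_mul, ← mul_assoc, hu, mul_assoc, Units.mul_inv, mul_one]
    · refine hconj t ht s hs h ?_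
      rwa [abs_sub_comm, abs_of_nonneg (sub_nonneg.mpr h)] at hst
  -- Near each time, similarity and rigidity put the curve in one orbit; connectedness of the
  -- interval does the rest.
  refine isPreconnected_Icc.induction₂ (fun s t => y t ∈ adjointOrbit 𝕜 (y s)) ?_ ?_ ?_ hs ht
  · intro s hs
    obtain ⟨D, hD⟩ := Submodule.exists_isCompl (LinearMap.ker (LieAlgebra.ad 𝕜 g (y s)))
    have h1 := (hy s hs).continuousWithinAt.eventually
      (eventually_exists_expAd_eq_of_conj (y s) hD.symm univ_mem)
    have h2 : ∀ᶠ t in 𝓝[Icc 0 T] s, |t - s| ≤ δ := by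
      refine nhdsWithin_le_nhds ?_
      filter_upwards [Metric.closedBall_mem_nhds s hδ] with t ht
      exact ht
    filter_upwards [h1, h2, self_mem_nhdsWithin] with t h1 h2 ht
    obtain ⟨a, -, h3⟩ := h1 (hconj' s hs t ht h2)
    rw [h3]
    exact expAd_mem_adjointOrbit _ _
  · intro r s t _ _ _ h1 h2
    rwa [← adjointOrbit_eq_of_mem h1]
  · intro s t _ _ h
    rw [adjointOrbit_eq_of_mem h]
    exact mem_adjointOrbit_self _

end Lax

/-! ### Symplectic leaves are connected components -/

section Leaf

variable {𝕜 g : Type*} [RCLike 𝕜] [NormedLieRing g] [NormedLieAlgebra 𝕜 g]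
  [FiniteDimensional 𝕜 g] [LieAlgebra.IsKilling 𝕜 g] [NormedSpace ℝ g] [IsScalarTower ℝ 𝕜 g]
  {t0 tp tm : g}

/-- A curve is differentiable if its composition with every linear functional is. -/
theorem hasDerivWithinAt_of_forall_dual {𝕜 V : Type*} [RCLike 𝕜] [NormedAddCommGroup V]
    [NormedSpace 𝕜 V] [FiniteDimensional 𝕜 V] [NormedSpace ℝ V] [IsScalarTower ℝ 𝕜 V]
    {γ : ℝ → V} {v : V} {s : Set ℝ} {t : ℝ}
    (h : ∀ α : V →L[𝕜] 𝕜, HasDerivWithinAt (fun r => α (γ r)) (α v) s t) :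
    HasDerivWithinAt γ v s t := by
  let e := (Module.finBasis 𝕜 V).equivFunL
  have h1 : HasDerivWithinAt (fun r => e (γ r)) (e v) s t := by
    rw [hasDerivWithinAt_pi]
    exact fun i => h ((ContinuousLinearMap.proj (R := 𝕜) (φ := fun _ => 𝕜) i).comp
      (e : V →L[𝕜] Fin (Module.finrank 𝕜 V) → 𝕜))
  have h2 := ((e.symm : _ →L[𝕜] V).restrictScalars ℝ).hasFDerivAt.comp_hasDerivWithinAt t h1
  have h3 : (fun r => e.symm (e (γ r))) = γ := funext fun r => e.symm_apply_apply _
  have h4 : HasDerivWithinAt (fun r => e.symm (e (γ r))) (e.symm (e v)) s t := h2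
  rwa [h3, e.symm_apply_apply] at h4

namespace SliceLift

variable (S : SliceLift 𝕜 tp tm) (ht : IsSl2Embedding t0 tp tm)
include S ht

/-- A Hamiltonian curve of a smooth function solves Hamilton's equation for every observable. -/
theorem hamiltonianFlow_of_hasDerivWithinAt {f : lowestWeight 𝕜 tm → 𝕜} (hf : IsSmooth f) {T : ℝ}
    {γ : ℝ → lowestWeight 𝕜 tm} (hT : 0 ≤ T)
    (hγ : ∀ t ∈ Icc 0 T, HasDerivWithinAt γ (S.X (γ t) (fderiv 𝕜 f (γ t))) (Icc 0 T) t) :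
    HamiltonianFlow (wBracket tp tm) (γ 0) (γ T) := by
  refine ⟨f, T, γ, hf, hT, rfl, rfl, fun h hh t htT => ?_⟩
  rw [S.wBracket_eq ht (hf.differentiable _) (hh.differentiable _)]
  exact ((hh.differentiable (γ t)).hasFDerivAt.restrictScalars ℝ).comp_hasDerivWithinAt t
    (hγ t htT)

omit ht in
/-- Along a Hamiltonian curve the orbit does not change. -/
theorem mem_adjointOrbit_of_hasDerivWithinAt {f : lowestWeight 𝕜 tm → 𝕜} (hf : IsSmooth f) {T : ℝ}
    {γ : ℝ → lowestWeight 𝕜 tm}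
    (hγ : ∀ t ∈ Icc 0 T, HasDerivWithinAt γ (S.X (γ t) (fderiv 𝕜 f (γ t))) (Icc 0 T) t)
    {s t : ℝ} (hs : s ∈ Icc 0 T) (htT : t ∈ Icc 0 T) :
    tp + (γ t : g) ∈ adjointOrbit 𝕜 (tp + (γ s : g)) := by
  refine FiniteW.mem_adjointOrbit_of_hasDerivWithinAt (y := fun t => tp + (γ t : g))
    (a := fun t => S.A (γ t) (fderiv 𝕜 f (γ t))) ?_ ?_ hs htT
  · intro r hr
    rw [← S.coe_X]
    exact (((lowestWeight 𝕜 tm).subtypeL.restrictScalars ℝ).hasFDerivAt.comp_hasDerivWithinAt r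
      (hγ r hr)).const_add tp
  · have h1 : Continuous fun w => S.A w (fderiv 𝕜 f w) :=
      (S.contDiff_A.clm_apply hf.contDiff_fderiv).continuous
    exact h1.comp_continuousOn fun r hr => (hγ r hr).continuousWithinAt

theorem hasDerivWithinAt_of_forall_smooth {f : lowestWeight 𝕜 tm → 𝕜} (hf : IsSmooth f)
    {γ : ℝ → lowestWeight 𝕜 tm} {s : Set ℝ} {t : ℝ}
    (hγ : ∀ h : lowestWeight 𝕜 tm → 𝕜, IsSmooth h →
      HasDerivWithinAt (fun r => h (γ r)) (wBracket tp tm f h (γ t)) s t) :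
    HasDerivWithinAt γ (S.X (γ t) (fderiv 𝕜 f (γ t))) s t := by
  refine hasDerivWithinAt_of_forall_dual (𝕜 := 𝕜) fun α => ?_
  have h1 := hγ α (isSmooth_clm α)
  rwa [S.wBracket_eq ht (hf.differentiable _) α.differentiableAt, α.fderiv] at h1

/-- With y = t₊ + γ, Hamilton's equation reads y' = [y, A df], so the whole curve is a connected
subset of the orbit slice. -/
theorem mem_connectedComponentIn_of_hamiltonianFlow {x : g} {w w' : lowestWeight 𝕜 tm}
    (hw : w ∈ orbitSlice 𝕜 tp tm x) (h : HamiltonianFlow (wBracket tp tm) w w') :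
    w' ∈ connectedComponentIn (orbitSlice 𝕜 tp tm x) w := by
  obtain ⟨f, T, γ, hf, hT, rfl, rfl, hγ⟩ := h
  have hγ' : ∀ t ∈ Icc 0 T, HasDerivWithinAt γ (S.X (γ t) (fderiv 𝕜 f (γ t))) (Icc 0 T) t :=
    fun t htT => S.hasDerivWithinAt_of_forall_smooth ht hf fun h hh => hγ h hh t htT
  have hc : IsPreconnected (γ '' Icc 0 T) :=
    isPreconnected_Icc.image _ fun t htT => (hγ' t htT).continuousWithinAt
  refine hc.subset_connectedComponentIn ⟨0, left_mem_Icc.mpr hT, rfl⟩ ?_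
    ⟨T, right_mem_Icc.mpr hT, rfl⟩
  rintro _ ⟨t, htT, rfl⟩
  have h1 := S.mem_adjointOrbit_of_hasDerivWithinAt hf hγ' (left_mem_Icc.mpr hT) htT
  rwa [adjointOrbit_eq_of_mem hw] at h1

theorem symplecticLeaf_subset {x : g} {w : lowestWeight 𝕜 tm} (hw : w ∈ orbitSlice 𝕜 tp tm x) :
    symplecticLeaf (wBracket tp tm) w ⊆ connectedComponentIn (orbitSlice 𝕜 tp tm x) w := by
  intro w' hw'
  have hw' : Relation.ReflTransGen (HamiltonianFlow (wBracket tp tm)) w w' := hw'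
  induction hw' with
  | refl => exact mem_connectedComponentIn hw
  | tail h₀ h ih =>
    have ih := ih h₀
    rw [connectedComponentIn_eq ih]
    exact S.mem_connectedComponentIn_of_hamiltonianFlow ht
      (connectedComponentIn_subset _ _ ih) h

/-- The points of an orbit near a given one are reached by a single Hamiltonian curve. -/
theorem eventually_hamiltonianFlow {x : g} {w : lowestWeight 𝕜 tm}
    (hw : w ∈ orbitSlice 𝕜 tp tm x) :
    ∀ᶠ z in 𝓝 w, z ∈ orbitSlice 𝕜 tp tm x → HamiltonianFlow (wBracket tp tm) w z := by
  set T := hamiltonianSpan (wBracket (𝕜 := 𝕜) tp tm) w with hT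
  have hrange : ∀ v : T, ∃ α, S.X w α = v := by
    intro v
    have h1 : (v : lowestWeight 𝕜 tm) ∈ hamiltonianSpan (wBracket (𝕜 := 𝕜) tp tm) w := v.2
    rw [S.hamiltonianSpan_eq ht] at h1
    exact h1
  let q : (lowestWeight 𝕜 tm →L[𝕜] 𝕜) →ₗ[𝕜] T := (S.X w).toLinearMap.codRestrict T fun α => by
    rw [hT, S.hamiltonianSpan_eq ht]; exact ⟨α, rfl⟩
  have hq : LinearMap.range q = ⊤ := by
    rw [LinearMap.range_eq_top]
    intro v
    obtain ⟨α, hα⟩ := hrange v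
    exact ⟨α, Subtype.ext hα⟩
  obtain ⟨s, hs⟩ := q.exists_rightInverse_of_surjective hq
  have hs' : ∀ v : T, S.X w (s v) = v := fun v =>
    congrArg Subtype.val (LinearMap.congr_fun hs v)
  -- For v ∈ T the linear function `sL v` has Hamiltonian vector v at w.
  let sL : T →L[𝕜] (lowestWeight 𝕜 tm →L[𝕜] 𝕜) := LinearMap.toContinuousLinearMap s
  have hB : ContDiff 𝕜 1 fun z => (S.X z).comp sL :=
    (S.contDiff_X.of_le (by simp)).clm_comp contDiff_const
  have hlin : ∀ (v : T) (z : lowestWeight 𝕜 tm), fderiv 𝕜 (sL v) z = sL v :=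
    fun v z => (sL v).fderiv
  have hcurve : ∀ (v : T) (ε : ℝ) (γ : ℝ → lowestWeight 𝕜 tm),
      (∀ t ∈ Icc 0 ε, HasDerivWithinAt γ ((S.X (γ t)).comp sL v) (Icc 0 ε) t) →
      ∀ t ∈ Icc 0 ε, HasDerivWithinAt γ (S.X (γ t) (fderiv 𝕜 (sL v) (γ t))) (Icc 0 ε) t := by
    intro v ε γ hγ t htε
    rw [hlin]
    exact hγ t htε
  have hmain := (isSubmanifoldAt_orbitSlice S ht hw).eventually_exists_curve hB
    (ContinuousLinearMap.ext hs') ?_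
  · filter_upwards [hmain] with z hz hzN
    obtain ⟨v, ε, γ, hε, h0, h1, hγ⟩ := hz hzN
    rw [← h0, ← h1]
    exact S.hamiltonianFlow_of_hasDerivWithinAt ht (isSmooth_clm (sL v)) hε (hcurve v ε γ hγ)
  · intro v ε γ hε h0 hγ
    have h1 := S.mem_connectedComponentIn_of_hamiltonianFlow ht (h0 ▸ hw)
      (S.hamiltonianFlow_of_hasDerivWithinAt ht (isSmooth_clm (sL v)) hε (hcurve v ε γ hγ))
    exact connectedComponentIn_subset _ _ h1

/-- Hamiltonian curves can be reversed. -/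
theorem hamiltonianFlow_symm {w w' : lowestWeight 𝕜 tm}
    (h : HamiltonianFlow (wBracket (𝕜 := 𝕜) tp tm) w w') :
    HamiltonianFlow (wBracket (𝕜 := 𝕜) tp tm) w' w := by
  obtain ⟨f, T, γ, hf, hT, rfl, rfl, hγ⟩ := h
  have hneg : IsSmooth (-f) := ContDiff.neg hf
  have hmaps : MapsTo (fun t : ℝ => T - t) (Icc 0 T) (Icc 0 T) := fun t htT =>
    ⟨by linarith [htT.2], by linarith [htT.1]⟩
  have h1 := S.hamiltonianFlow_of_hasDerivWithinAt ht hneg (γ := fun t => γ (T - t)) hT ?_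
  · simpa using h1
  · intro t htT
    have h2 := S.hasDerivWithinAt_of_forall_smooth ht hf
      fun h hh => hγ h hh (T - t) (hmaps htT)
    have h3 := h2.scomp t ((hasDerivWithinAt_id t (Icc 0 T)).const_sub T) hmaps
    refine h3.congr_deriv ?_
    rw [fderiv_neg, map_neg, neg_one_smul]

/-- Reachability is an equivalence relation whose classes are open in the orbit slice by
`eventually_hamiltonianFlow`, so a connected component lies in one class. -/
theorem symplecticLeaf_eq {x : g} {w : lowestWeight 𝕜 tm} (hw : w ∈ orbitSlice 𝕜 tp tm x) :
    symplecticLeaf (wBracket tp tm) w = connectedComponentIn (orbitSlice 𝕜 tp tm x) w := by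
  refine Subset.antisymm (S.symplecticLeaf_subset ht hw) fun w' hw' => ?_
  refine isPreconnected_connectedComponentIn.induction₂
    (Relation.ReflTransGen (HamiltonianFlow (wBracket (𝕜 := 𝕜) tp tm))) ?_ ?_ ?_
    (mem_connectedComponentIn hw) hw'
  · intro z hz
    have hsub := connectedComponentIn_subset (orbitSlice 𝕜 tp tm x) w
    filter_upwards [nhdsWithin_le_nhds (S.eventually_hamiltonianFlow ht (hsub hz)),
      self_mem_nhdsWithin] with z' h1 h2
    exact .single (h1 (hsub h2))
  · exact fun _ _ _ _ _ _ h1 h2 => h1.trans h2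
  · intro z z' _ _ h
    have : Std.Symm (HamiltonianFlow (wBracket (𝕜 := 𝕜) tp tm)) :=
      ⟨fun _ _ => S.hamiltonianFlow_symm ht⟩
    exact Std.Symm.symm _ _ h

end SliceLift

end Leaf

/-! ### Regular elements and centralizer dimensions -/

section Regular

/-- The Engel subalgebra of a regular element is a Cartan subalgebra. -/
theorem isCartanSubalgebra_engel_of_isRegular {K L : Type*} [Field K] [Infinite K] [LieRing L]
    [LieAlgebra K L] [Module.Finite K L] {x : L} (hx : LieAlgebra.IsRegular K x) :
    (LieSubalgebra.engel K x).IsCartanSubalgebra := by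
  refine ⟨LieSubalgebra.isNilpotent_of_forall_le_engel _ fun y hy => ?_,
    LieSubalgebra.normalizer_engel _ _⟩
  -- Regularity gives this Engel subalgebra least dimension, so it is minimal, hence least, among
  -- those of its own elements. Engel's criterion then makes it nilpotent.
  let Ex : {LieSubalgebra.engel K z | z ∈ LieSubalgebra.engel K x} :=
    ⟨LieSubalgebra.engel K x, x, LieSubalgebra.self_mem_engel _ _, rfl⟩
  have hcard : (Module.finrank K L : Cardinal) ≤ Cardinal.mk K :=
    Cardinal.natCast_le_aleph0.trans (Cardinal.infinite_iff.mp inferInstance)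
  have hbot : IsBot Ex := by
    refine LieAlgebra.engel_isBot_of_isMin hcard (LieSubalgebra.engel K x) Ex le_rfl ?_
    rintro ⟨_, y, hy, rfl⟩ hyx
    have h1 : Module.finrank K (LieSubalgebra.engel K x) ≤
        Module.finrank K (LieSubalgebra.engel K y) := by
      rw [(LieAlgebra.isRegular_iff_finrank_engel_eq_rank K x).mp hx]
      exact LieAlgebra.rank_le_finrank_engel K y
    have h2 : LieSubalgebra.engel K y = LieSubalgebra.engel K x :=
      LieSubalgebra.toSubmodule_injective (Submodule.eq_of_le_of_finrank_le hyx h1)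
    exact h2.ge
  exact hbot ⟨LieSubalgebra.engel K y, y, hy, rfl⟩

/-- Cartan subalgebras are abelian when the Killing form is nondegenerate, so the Engel subalgebra
of x centralizes x. -/
theorem finrank_ker_ad_of_isRegular {K L : Type*} [Field K] [Infinite K] [LieRing L]
    [LieAlgebra K L] [Module.Finite K L] [LieAlgebra.IsKilling K L] {x : L}
    (hx : LieAlgebra.IsRegular K x) :
    Module.finrank K (LinearMap.ker (LieAlgebra.ad K L x)) = LieAlgebra.rank K L := by
  have := isCartanSubalgebra_engel_of_isRegular hx
  rw [← (LieAlgebra.isRegular_iff_finrank_engel_eq_rank K x).mp hx]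
  have h : LinearMap.ker (LieAlgebra.ad K L x) = (LieSubalgebra.engel K x).toSubmodule := by
    ext y
    rw [LinearMap.mem_ker, LieSubalgebra.mem_toSubmodule]
    constructor
    · intro hy
      rw [LieSubalgebra.mem_engel_iff]
      exact ⟨1, by rwa [pow_one]⟩
    · intro hy
      exact congrArg Subtype.val (trivial_lie_zero (LieSubalgebra.engel K x)
        (LieSubalgebra.engel K x) ⟨x, LieSubalgebra.self_mem_engel K x⟩ ⟨y, hy⟩)
  rw [h]
  rfl

variable {𝕜 g : Type*} [RCLike 𝕜] [NormedLieRing g] [NormedLieAlgebra 𝕜 g]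
  [FiniteDimensional 𝕜 g]

theorem isOpen_finrank_ker_ad_le (n : ℕ) :
    IsOpen {y : g | Module.finrank 𝕜 (LinearMap.ker (LieAlgebra.ad 𝕜 g y)) ≤ n} := by
  have h := (isOpen_setOfPred_nat_le_rank (𝕜 := 𝕜) (E := g) (F := g)
    (Module.finrank 𝕜 g - n)).preimage (lieL 𝕜 g).continuous
  convert h using 1
  ext y
  have h1 := LinearMap.finrank_range_add_finrank_ker (LieAlgebra.ad 𝕜 g y)
  have h2 : ((lieL 𝕜 g y : g →L[𝕜] g) : g →ₗ[𝕜] g).rank =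
      (Module.finrank 𝕜 (LinearMap.range (LieAlgebra.ad 𝕜 g y)) : Cardinal) :=
    (Module.finrank_eq_rank 𝕜 _).symm
  simp only [mem_preimage, mem_ofPred_eq]
  rw [h2, Nat.cast_le]
  omega

variable [NormedSpace ℝ g]

variable (𝕜 g) in
-- Regularity is the nonvanishing of a polynomial which is not identically zero; the identity
-- theorem gives density.
theorem dense_isRegular : Dense {y : g | LieAlgebra.IsRegular 𝕜 y} := by
  classical
  let b := Module.finBasis 𝕜 g
  obtain ⟨p, hp⟩ : ∃ p : MvPolynomial (Fin (Module.finrank 𝕜 g)) 𝕜, ∀ y : g,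
      LieAlgebra.IsRegular 𝕜 y ↔ MvPolynomial.eval (b.equivFun y) p ≠ 0 :=
    ⟨_, fun y => LieAlgebra.isRegular_iff_coeff_polyCharpoly_rank_ne_zero 𝕜 b y⟩
  have han : AnalyticOnNhd 𝕜 (fun y => MvPolynomial.eval (b.equivFun y) p) univ :=
    AnalyticOnNhd.eval_linearMap b.equivFun.toLinearMap p
  rw [dense_iff_inter_open]
  intro O hO ⟨y, hy⟩
  by_contra hne
  have hzero : ∀ z ∈ O, MvPolynomial.eval (b.equivFun z) p = 0 := by
    intro z hz
    by_contra h
    exact hne ⟨z, hz, (hp z).mpr h⟩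
  have heq := han.eq_of_eventuallyEq (analyticOnNhd_const (v := (0 : 𝕜))) (z₀ := y)
    (by filter_upwards [hO.mem_nhds hy] with z hz using hzero z hz)
  obtain ⟨x, hx⟩ := LieAlgebra.exists_isRegular 𝕜 g
  exact (hp x).mp hx (congrFun heq x)

variable [LieAlgebra.IsKilling 𝕜 g]

/-- Centralizer dimension does not increase on passing to nearby points, and some of these are
regular. -/
theorem rank_le_finrank_ker_ad (y : g) :
    LieAlgebra.rank 𝕜 g ≤ Module.finrank 𝕜 (LinearMap.ker (LieAlgebra.ad 𝕜 g y)) := by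
  obtain ⟨z, hz, hreg⟩ := (dense_isRegular 𝕜 g).inter_open_nonempty _
    (isOpen_finrank_ker_ad_le (𝕜 := 𝕜) (Module.finrank 𝕜 (LinearMap.ker (LieAlgebra.ad 𝕜 g y))))
    ⟨y, le_refl (Module.finrank 𝕜 (LinearMap.ker (LieAlgebra.ad 𝕜 g y)))⟩
  rw [← finrank_ker_ad_of_isRegular hreg]
  exact hz

end Regular

/-! ### Generic points of the slice -/

section Generic

variable {𝕜 g : Type*} [RCLike 𝕜] [NormedLieRing g] [NormedLieAlgebra 𝕜 g]
  [FiniteDimensional 𝕜 g] [NormedSpace ℝ g] [LieAlgebra.IsKilling 𝕜 g] {t0 tp tm : g}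

theorem isOpen_generic :
    IsOpen {w : lowestWeight 𝕜 tm | Module.finrank 𝕜
      (LinearMap.ker (LieAlgebra.ad 𝕜 g (tp + (w : g)))) = LieAlgebra.rank 𝕜 g} := by
  have hc : Continuous fun w : lowestWeight 𝕜 tm => tp + (w : g) := by fun_prop
  convert (isOpen_finrank_ker_ad_le (𝕜 := 𝕜) (LieAlgebra.rank 𝕜 g)).preimage hc using 1
  ext w
  exact (rank_le_finrank_ker_ad (tp + (w : g))).ge_iff_eq'.symm

omit [NormedSpace ℝ g] [LieAlgebra.IsKilling 𝕜 g] in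
/-- The orbits through a neighbourhood of a point of the slice fill a neighbourhood in `g`. -/
theorem IsSl2Embedding.map_nhds_expAd (ht : IsSl2Embedding t0 tp tm) (w : lowestWeight 𝕜 tm) :
    map (fun p : (⊤ : Submodule 𝕜 g) × lowestWeight 𝕜 tm =>
      expAd 𝕜 (p.1 : g) (tp + (w : g) + (lowestWeight 𝕜 tm).subtypeL p.2)) (𝓝 0) =
      𝓝 (tp + (w : g)) := by
  have : CompleteSpace g := FiniteDimensional.complete 𝕜 g
  have : CompleteSpace (⊤ : Submodule 𝕜 g) := FiniteDimensional.complete 𝕜 _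
  have : CompleteSpace (lowestWeight 𝕜 tm) := FiniteDimensional.complete 𝕜 _
  have h := (hasStrictFDerivAt_expAd_apply_add (tp + (w : g)) ⊤
    (lowestWeight 𝕜 tm).subtypeL).map_nhds_eq_of_surj ?_
  · rw [h]
    simp [expAd_zero]
  · refine eq_top_iff.mpr ((ht.range_ad_sup_lowestWeight w).ge.trans (sup_le ?_ ?_))
    · rintro _ ⟨a, rfl⟩
      refine ⟨(⟨-a, trivial⟩, 0), ?_⟩
      change ⁅-a, tp + (w : g)⁆ + ((0 : lowestWeight 𝕜 tm) : g) = ⁅tp + (w : g), a⁆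
      rw [neg_lie, lie_skew, Submodule.coe_zero, add_zero]
    · intro v hv
      refine ⟨(0, ⟨v, hv⟩), ?_⟩
      change ⁅(0 : g), tp + (w : g)⁆ + v = v
      rw [zero_lie, zero_add]

/-- Orbits through any open piece of the slice fill an open set of g, which contains a regular
element. Centralizer dimension is constant on its orbit. -/
theorem IsSl2Embedding.dense_generic (ht : IsSl2Embedding t0 tp tm) :
    Dense {w : lowestWeight 𝕜 tm | Module.finrank 𝕜
      (LinearMap.ker (LieAlgebra.ad 𝕜 g (tp + (w : g)))) = LieAlgebra.rank 𝕜 g} := by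
  rw [dense_iff_inter_open]
  rintro O hO ⟨w, hw⟩
  have hN : ∀ᶠ p : (⊤ : Submodule 𝕜 g) × lowestWeight 𝕜 tm in 𝓝 0, w + p.2 ∈ O := by
    have hc : Continuous fun p : (⊤ : Submodule 𝕜 g) × lowestWeight 𝕜 tm => w + p.2 := by fun_prop
    refine hc.continuousAt.eventually (hO.mem_nhds ?_)
    simpa using hw
  have himage : ∀ᶠ z in 𝓝 (tp + (w : g)), ∃ (a : g) (v : lowestWeight 𝕜 tm), v ∈ O ∧
      z = expAd 𝕜 a (tp + (v : g)) := by
    rw [← ht.map_nhds_expAd w, eventually_map]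
    filter_upwards [hN] with p hp
    refine ⟨p.1, w + p.2, hp, ?_⟩
    rw [Submodule.coe_add, add_assoc]
    rfl
  obtain ⟨z, hreg, a, v, hv, rfl⟩ := (dense_isRegular 𝕜 g).inter_nhds_nonempty himage
  refine ⟨v, hv, ?_⟩
  rw [← finrank_ker_ad_of_isRegular hreg]
  exact (finrank_ker_ad_eq_of_mem_adjointOrbit (expAd_mem_adjointOrbit a _)).symm

end Generic

end FiniteW

end

theorem mainTheorem7 {𝕜 g : Type*} [RCLike 𝕜] [FiniteW.NormedLieRing g]
    [FiniteW.NormedLieAlgebra 𝕜 g] [FiniteDimensional 𝕜 g] [LieAlgebra.IsSimple 𝕜 g]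
    (t0 tp tm : g) (ht : FiniteW.IsSl2Embedding t0 tp tm) :
    -- the finite W algebra is well defined: the constraints are second class on the slice, and the
    -- Dirac bracket is a Poisson bracket
    ((∀ w : FiniteW.lowestWeight 𝕜 tm,
        IsUnit (FiniteW.constraintMatrix 𝕜 tp tm (tp + (w : g)))) ∧
      FiniteW.IsPoissonBracket (FiniteW.wBracket (𝕜 := 𝕜) tp tm)) ∧
    -- the intersections of orbits with the slice are the integral manifolds of the Hamiltonian
    -- vector fields, and their connected components are the symplectic leaves
    (∀ x : g,
      FiniteW.IsSymplecticSubmanifold (FiniteW.wBracket (𝕜 := 𝕜) tp tm)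
        (FiniteW.orbitSlice 𝕜 tp tm x) ∧
      (∀ w ∈ FiniteW.orbitSlice 𝕜 tp tm x,
        FiniteW.symplecticLeaf (FiniteW.wBracket (𝕜 := 𝕜) tp tm) w =
          connectedComponentIn (FiniteW.orbitSlice 𝕜 tp tm x) w) ∧
      (IsConnected (FiniteW.orbitSlice 𝕜 tp tm x) →
        FiniteW.IsSymplecticLeaf (FiniteW.wBracket (𝕜 := 𝕜) tp tm)
          (FiniteW.orbitSlice 𝕜 tp tm x))) ∧
    -- the leaves in orbits of dimension `dim g - rank g` have dimension `dim g_lw - rank g`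
    (∀ x : g, Module.finrank 𝕜 (LinearMap.ker (LieAlgebra.ad 𝕜 g x)) = LieAlgebra.rank 𝕜 g →
      ∀ w ∈ FiniteW.orbitSlice 𝕜 tp tm x,
        Module.finrank 𝕜 (FiniteW.hamiltonianSpan (FiniteW.wBracket (𝕜 := 𝕜) tp tm) w) +
          LieAlgebra.rank 𝕜 g = Module.finrank 𝕜 (FiniteW.lowestWeight 𝕜 tm)) ∧
    -- and these leaves fill an open dense subset
    IsOpen {w : FiniteW.lowestWeight 𝕜 tm |
      Module.finrank 𝕜 (FiniteW.hamiltonianSpan (FiniteW.wBracket (𝕜 := 𝕜) tp tm) w) +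
        LieAlgebra.rank 𝕜 g = Module.finrank 𝕜 (FiniteW.lowestWeight 𝕜 tm)} ∧
    Dense {w : FiniteW.lowestWeight 𝕜 tm |
      Module.finrank 𝕜 (FiniteW.hamiltonianSpan (FiniteW.wBracket (𝕜 := 𝕜) tp tm) w) +
        LieAlgebra.rank 𝕜 g = Module.finrank 𝕜 (FiniteW.lowestWeight 𝕜 tm)} := by
  let := NormedSpace.restrictScalars ℝ 𝕜 g
  have : IsScalarTower ℝ 𝕜 g := IsScalarTower.of_algebraMap_smul fun r x => rfl
  obtain ⟨S⟩ := ht.nonempty_sliceLift (𝕜 := 𝕜)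
  -- The leaf dimension condition is translated into one on centralizers, which is invariant along
  -- orbits.
  have hdim : ∀ w : FiniteW.lowestWeight 𝕜 tm,
      Module.finrank 𝕜 (FiniteW.hamiltonianSpan (FiniteW.wBracket (𝕜 := 𝕜) tp tm) w) +
        LieAlgebra.rank 𝕜 g = Module.finrank 𝕜 (FiniteW.lowestWeight 𝕜 tm) ↔
      Module.finrank 𝕜 (LinearMap.ker (LieAlgebra.ad 𝕜 g (tp + (w : g)))) =
        LieAlgebra.rank 𝕜 g := by
    intro w
    rw [← S.finrank_hamiltonianSpan ht w, Nat.add_left_cancel_iff, eq_comm]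
  refine ⟨⟨FiniteW.isUnit_constraintMatrix ht, S.isPoissonBracket_wBracket ht⟩, fun x =>
    ⟨FiniteW.isSymplecticSubmanifold_orbitSlice S ht x, fun w hw => S.symplecticLeaf_eq ht hw,
      fun hx => ?_⟩, fun x hx w hw => ?_, ?_, ?_⟩
  · obtain ⟨w, hw⟩ := hx.nonempty
    refine ⟨w, ?_⟩
    rw [S.symplecticLeaf_eq ht hw]
    exact (hx.isPreconnected.connectedComponentIn hw).symm
  · rw [hdim, ← hx]
    exact FiniteW.finrank_ker_ad_eq_of_mem_adjointOrbit hw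
  · simp only [hdim]
    exact FiniteW.isOpen_generic
  · simp only [hdim]
    exact ht.dense_generic
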